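/- Let $F:\mathbb{R}^d\to\mathbb{R}$ be convex, let $\mathcal W\subset\mathbb{R}^d$ be closed and convex, let $\lambda>0$ and $G\in\mathbb R$, and let $x^*\in\mathcal W$ minimize $F$ over $\mathcal W$. Assume that $\|g\|\le G$ for all $x\in\mathcal W$ and $g\in\partial F(x)$ ($G$-Lipschitz), and that $F(y)\ge F(x)+\langle g,y-x\rangle+\frac{\lambda}{2}\|y-x\|^2$ for all $x,y\in\mathcal W$ and $g\in\partial F(x)$ ($\lambda$-strong convexity over $\mathcal W$). Given $T\ge 1$, let $k=\min\{i\ge 0: T2^{-i}\le 1\}$, $T_i=T-\lceil T2^{-i}\rceil$ for $0\le i\le k$, $T_{k+1}=T$, and $\alpha_t=\frac{2^{-i}}{\lambda t}$ for $T_i<t\le T_{i+1}$, $0\le i\le k$. Let $\Pi_{\mathcal W}$ be the Euclidean projection onto $\mathcal W$ and $x_1\in\mathcal W$ a deterministic starting point. SGD: let $\hat g_1,\dots,\hat g_T$ be independent random vector fields on $\mathbb R^d$, i.e. $\hat g_t(x)=h_t(\xi_t,x)$ with $\xi_1,\dots,\xi_T$ independent random elements and $h_t$ jointly measurable, such that for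 all $t\le T$ and $x\in\mathcal W$ one has $\mathbb E[\hat g_t(x)]\in\partial F(x)$ and $\|\hat g_t(x)\|\le G$ almost surely. Let $x_{t+1}=\Pi_{\mathcal W}(x_t-\alpha_t\hat g_t(x_t))$. Then $F(x_T)$ is integrable and $$\mathbb{E}[F(x_T)]\le F(x^*)+\frac{130\,G^2}{\lambda T}.$$ Furthermore, for every $0<\delta\le 1/e$, with probability at least $1-\delta$, $$|F(x_T)-F(x^*)|\le C\,\frac{G^2\log(1/\delta)}{\lambda T},$$ where $C>0$ is a universal constant, i.e. it depends on none of $d,F,\mathcal W,G,\lambda,T,\delta,x_1$ or the stochastic subgradients. GD: under the same assumptions on $F$, $\mathcal W$, $x^*$ and with the same step sizes, the deterministic iterates $x_{t+1}=\Pi_{\mathcal W}(x_t-\alpha_t g_t(x_t))$ from $x_1\in\mathcal W$, with arbitrary selections $g_t(x)\in\partial F(x)$, $x\in\mathcal W$, satisfy $$F(x_T)\le F(x^*)+\frac{130\,G^2}{\lambda T}.$$ -/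

import Mathlib

open MeasureTheory ProbabilityTheory

namespace LastIterate

/-- The subdifferential of `F` at `x`: all `g` with `F y ≥ F x + ⟨g, y - x⟩` for every `y`. -/
def subdifferential {E : Type*} [NormedAddCommGroup E] [InnerProductSpace ℝ E]
    (F : E → ℝ) (x : E) : Set E :=
  {g | ∀ y, F x + inner ℝ g (y - x) ≤ F y}

/-- `F` is `G`-Lipschitz over `W`: every subgradient at every point of `W` has norm at most `G`. -/
def LipschitzOver {E : Type*} [NormedAddCommGroup E] [InnerProductSpace ℝ E]
    (F : E → ℝ) (W : Set E) (G : ℝ) : Prop :=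
  ∀ x ∈ W, ∀ g ∈ subdifferential F x, ‖g‖ ≤ G

/-- `F` is `lam`-strongly convex over `W`. -/
def StronglyConvexOver {E : Type*} [NormedAddCommGroup E] [InnerProductSpace ℝ E]
    (F : E → ℝ) (W : Set E) (lam : ℝ) : Prop :=
  ∀ x ∈ W, ∀ y ∈ W, ∀ g ∈ subdifferential F x,
    F x + inner ℝ g (y - x) + lam / 2 * ‖y - x‖ ^ 2 ≤ F y

open Classical in
/-- The projection onto `W`: the nearest point of `W`
(it exists and is unique when `W` is nonempty, closed and convex). -/
noncomputable def proj {E : Type*} [NormedAddCommGroup E] (W : Set E) (x : E) : E :=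
  if h : ∃ y ∈ W, ∀ z ∈ W, ‖x - y‖ ≤ ‖x - z‖ then h.choose else x

theorem proj_spec {E : Type*} [NormedAddCommGroup E] [ProperSpace E] {W : Set E}
    (hW : IsClosed W) (hne : W.Nonempty) (x : E) :
    proj W x ∈ W ∧ ∀ z ∈ W, ‖x - proj W x‖ ≤ ‖x - z‖ := by
  have h : ∃ y ∈ W, ∀ z ∈ W, ‖x - y‖ ≤ ‖x - z‖ := by
    obtain ⟨y, hy, hxy⟩ := hW.exists_infDist_eq_dist hne x
    refine ⟨y, hy, fun z hz => ?_⟩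
    rw [← dist_eq_norm, ← dist_eq_norm, ← hxy]
    exact Metric.infDist_le_dist_of_mem hz
  unfold proj
  rw [dif_pos h]
  exact h.choose_spec

/-- `k = inf {i : T * 2 ^ (-i) ≤ 1}`. -/
noncomputable def lastPhase (T : ℕ) : ℕ := sInf {i : ℕ | (T : ℝ) / 2 ^ i ≤ 1}

/-- The breakpoints `T_i = T - ⌈T * 2 ^ (-i)⌉` for `i ≤ k`, and `T_i = T` for `i > k`. -/
noncomputable def breakpoint (T i : ℕ) : ℕ :=
  if i ≤ lastPhase T then T - ⌈(T : ℝ) / 2 ^ i⌉₊ else T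

open Classical in
/-- The phase of time `t`: the greatest `i ≤ k` with `T_i < t`. -/
noncomputable def phase (T t : ℕ) : ℕ :=
  Nat.findGreatest (fun i => breakpoint T i < t) (lastPhase T)

/-- The modified step size `2 ^ (-i) / (lam * t)` for `T_i < t ≤ T_{i+1}`, `0 ≤ i ≤ k`. -/
noncomputable def stepSize (lam : ℝ) (T t : ℕ) : ℝ :=
  1 / 2 ^ phase T t * (1 / (lam * t))

theorem phase_eq {T t i : ℕ} (hi : i ≤ lastPhase T) (h1 : breakpoint T i < t)
    (h2 : t ≤ breakpoint T (i + 1)) : phase T t = i := by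
  classical
  unfold phase
  rw [Nat.findGreatest_eq_iff]
  refine ⟨hi, fun _ => h1, fun j hij hj => not_lt.2 (h2.trans ?_)⟩
  unfold breakpoint
  rw [if_pos (show i + 1 ≤ lastPhase T by omega), if_pos hj]
  refine Nat.sub_le_sub_left (Nat.ceil_mono ?_) T
  gcongr
  · norm_num
  · omega

theorem stepSize_eq (lam : ℝ) {T t i : ℕ} (hi : i ≤ lastPhase T) (h1 : breakpoint T i < t)
    (h2 : t ≤ breakpoint T (i + 1)) : stepSize lam T t = 1 / 2 ^ i * (1 / (lam * t)) := by
  rw [stepSize, phase_eq hi h1 h2]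

/-- The projected (sub)gradient iteration with step sizes `α` and directions `g`, started at `x₁`:
`x_1 = x₁` and `x_{t+1} = Π_W (x_t - α_t • g_t (x_t))` for `t ≥ 1` (the index `0` is not used). -/
noncomputable def iterate {E : Type*} [NormedAddCommGroup E] [NormedSpace ℝ E]
    (W : Set E) (α : ℕ → ℝ) (g : ℕ → E → E) (x₁ : E) : ℕ → E
  | 0 => x₁
  | 1 => x₁
  | t + 2 =>
      proj W (iterate W α g x₁ (t + 1)
        - α (t + 1) • g (t + 1) (iterate W α g x₁ (t + 1)))

/-- `ĝ_t(x) = h t (ξ t ω) x`, `1 ≤ t ≤ T`, are independent unbiased stochastic subgradients of `F`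
over `W`, of norm at most `G`: the noise `ξ t` of the different steps is independent, the oracle is
jointly measurable in noise and point, and for each `x ∈ W` the mean of `ĝ_t(x)` is a subgradient
and `‖ĝ_t(x)‖ ≤ G` almost surely. -/
structure IsStochasticOracle {E : Type*} [NormedAddCommGroup E] [InnerProductSpace ℝ E]
    [MeasurableSpace E] {Ω : Type*} [MeasurableSpace Ω] (μ : Measure Ω)
    {Ξ : ℕ → Type*} [∀ t, MeasurableSpace (Ξ t)]
    (F : E → ℝ) (W : Set E) (G : ℝ) (T : ℕ) (ξ : ∀ t, Ω → Ξ t) (h : ∀ t, Ξ t → E → E) : Prop where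
  measurable_noise : ∀ t ∈ Set.Icc 1 T, Measurable (ξ t)
  indep : iIndepFun (fun (t : Set.Icc 1 T) => ξ t) μ
  measurable_oracle : ∀ t ∈ Set.Icc 1 T, Measurable (Function.uncurry (h t))
  unbiased : ∀ t ∈ Set.Icc 1 T, ∀ x ∈ W, (∫ ω, h t (ξ t ω) x ∂μ) ∈ subdifferential F x
  bounded : ∀ t ∈ Set.Icc 1 T, ∀ x ∈ W, ∀ᵐ ω ∂μ, ‖h t (ξ t ω) x‖ ≤ G

/-- The SGD iterates `x_1, x_2, …` driven by the stochastic subgradients `h t (ξ t ω)`. -/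
noncomputable def sgd {E : Type*} [NormedAddCommGroup E] [NormedSpace ℝ E] {Ω : Type*}
    {Ξ : ℕ → Type*} (W : Set E) (α : ℕ → ℝ) (ξ : ∀ t, Ω → Ξ t) (h : ∀ t, Ξ t → E → E)
    (x₁ : E) (t : ℕ) (ω : Ω) : E :=
  iterate W α (fun s => h s (ξ s ω)) x₁ t

end LastIterate

open LastIterate

/-! The steps split at T/2. In the first half the step size is 1/(λt), and strong convexity gives
d_{t+1} ≤ (1 - 2/t) d_t + G²/(λt)² for the squared distance to x*, so d = O(G²/(λ²T)) at the
midpoint (`sq_dist_recursion`). In the second half the step size α_t is within constant factors of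
(T+1-t)/(λT²); hence the sum S_t of the remaining step sizes is at least of order (T+1-t)²/(λT²),
and α_t²/S_{t+1} ≤ 128/(λT²).

To reach the last iterate instead of an average, x_t is compared with a moving reference point y_t,
which rests at x* up to the midpoint and is then pulled towards x_t with weight p = α_t/S_t. The
potential is ‖x_t - y_t‖²/S_t + 2(F(y_t) - F(x*)). In one step the subgradient inequality gains
2p(F(x_t) - F(y_t)), and this is what convexity charges for moving y_t, so F(x_t) cancels: the
potential grows by at most α_t²G²/S_{t+1} plus centered noise (`potential_step_le`). At time T it
controls F(x_T) up to G²α_T/2 (`potential_last_le`).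

For SGD, independence allows the state to be frozen while the current noise is integrated out
(`integral_sgdState_succ_le`), so the noise vanishes in the mean. For the tail, Hoeffding's lemma
bounds the exponential moment of the noise with a variance proxy proportional to the squared
distance to x* or to y_t; the contraction of that same distance in the step absorbs it. Exponential
moments thus stay bounded, and Chernoff's inequality concludes. -/

namespace LastIterate

/-! ### Euclidean projection onto a closed convex set. -/

section Projection

variable {E : Type*} [NormedAddCommGroup E] [InnerProductSpace ℝ E] [ProperSpace E] {W : Set E}

theorem inner_sub_proj_le_zero (hW : IsClosed W) (hc : Convex ℝ W) (x : E) {u : E} (hu : u ∈ W) :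
    inner ℝ (x - proj W x) (u - proj W x) ≤ 0 := by
  obtain ⟨hp, hmin⟩ := proj_spec hW ⟨u, hu⟩ x
  refine (norm_eq_iInf_iff_real_inner_le_zero hc hp).1 ?_ u hu
  have : Nonempty W := ⟨⟨u, hu⟩⟩
  refine le_antisymm (le_ciInf fun w => hmin w w.2) ?_
  exact ciInf_le (f := fun w : W => ‖x - w‖)
    ⟨0, Set.forall_mem_range.2 fun _ => norm_nonneg _⟩ ⟨proj W x, hp⟩

theorem norm_proj_sub_sq_le (hW : IsClosed W) (hc : Convex ℝ W) (x : E) {u : E} (hu : u ∈ W) :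
    ‖proj W x - u‖ ^ 2 ≤ ‖x - u‖ ^ 2 := by
  have h := inner_sub_proj_le_zero hW hc x hu
  have e : x - u = (x - proj W x) - (u - proj W x) := by abel
  rw [e, norm_sub_sq_real (x - proj W x), norm_sub_rev (proj W x) u]
  nlinarith [sq_nonneg ‖x - proj W x‖]

/-- Nonexpansiveness, obtained by adding the two variational inequalities. It serves the
measurability of the iterates. -/
theorem continuous_proj (hW : IsClosed W) (hc : Convex ℝ W) (hne : W.Nonempty) :
    Continuous (proj W) := by
  refine LipschitzWith.continuous (K := 1) (LipschitzWith.of_dist_le_mul fun x y => ?_)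
  rw [NNReal.coe_one, one_mul, dist_eq_norm, dist_eq_norm]
  have h1 := inner_sub_proj_le_zero hW hc x (proj_spec hW hne y).1
  have h2 := inner_sub_proj_le_zero hW hc y (proj_spec hW hne x).1
  have h3 : ‖proj W x - proj W y‖ ^ 2 ≤ inner ℝ (x - y) (proj W x - proj W y) := by
    rw [← real_inner_self_eq_norm_sq]
    simp only [inner_sub_left, inner_sub_right] at *
    linarith
  have h4 := h3.trans (real_inner_le_norm _ _)
  by_contra! h
  nlinarith [norm_nonneg (x - y)]

/-- One projected step, measured from a point of `W`. -/
theorem norm_proj_step_sq_le (hW : IsClosed W) (hc : Convex ℝ W) (x v : E) (a : ℝ) {u : E}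
    (hu : u ∈ W) :
    ‖proj W (x - a • v) - u‖ ^ 2
      ≤ ‖x - u‖ ^ 2 - 2 * a * inner ℝ v (x - u) + a ^ 2 * ‖v‖ ^ 2 := by
  refine (norm_proj_sub_sq_le hW hc _ hu).trans (le_of_eq ?_)
  have e : x - a • v - u = (x - u) - a • v := by abel
  rw [e, norm_sub_sq_real, real_inner_smul_right, real_inner_comm, norm_smul, mul_pow,
    Real.norm_eq_abs, sq_abs]
  ring

end Projection

/-! ### Deterministic one-step inequalities. -/

section Convexity

variable {E : Type*} [NormedAddCommGroup E] [InnerProductSpace ℝ E] {F : E → ℝ} {W : Set E}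
  {G lam : ℝ} {xs : E}

theorem sub_le_of_lipschitzOver (hL : LipschitzOver F W G)
    (hsub : ∀ x ∈ W, (subdifferential F x).Nonempty) {x : E} (hx : x ∈ W) (y : E) :
    F x - F y ≤ G * ‖x - y‖ := by
  obtain ⟨g, hg⟩ := hsub x hx
  have h1 := hg y
  have h2 := real_inner_le_norm g (x - y)
  have h3 := mul_le_mul_of_nonneg_right (hL x hx g hg) (norm_nonneg (x - y))
  rw [← neg_sub x y, inner_neg_right] at h1
  linarith

/-- Quadratic growth of a strongly convex function around its minimizer. -/
theorem growth_of_isMinOn (hc : Convex ℝ W) (hS : StronglyConvexOver F W lam)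
    (hsub : ∀ x ∈ W, (subdifferential F x).Nonempty) (hxs : xs ∈ W) (hmin : IsMinOn F W xs)
    {x : E} (hx : x ∈ W) : lam / 2 * ‖x - xs‖ ^ 2 ≤ F x - F xs := by
  -- Strong convexity is used at a point z near `xs`, since an arbitrary subgradient at `xs` itself
  -- need not satisfy the first-order optimality condition. With weights 1 - θ and θ the subgradient
  -- at z cancels; then θ → 0.
  have key : ∀ θ : ℝ, 0 < θ → θ < 1 → lam / 2 * (1 - θ) * ‖x - xs‖ ^ 2 ≤ F x - F xs := by
    intro θ h0 h1
    set z := (1 - θ) • xs + θ • x with hz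
    have hzW : z ∈ W := hc hxs hx (by linarith) h0.le (by ring)
    obtain ⟨g, hg⟩ := hsub z hzW
    have e1 : xs - z = (-θ) • (x - xs) := by rw [hz]; module
    have e2 : x - z = (1 - θ) • (x - xs) := by rw [hz]; module
    have i1 := hS z hzW xs hxs g hg
    have i2 := hS z hzW x hx g hg
    have i3 : F xs ≤ F z := hmin hzW
    rw [e1, real_inner_smul_right, norm_smul, mul_pow, Real.norm_eq_abs, sq_abs] at i1
    rw [e2, real_inner_smul_right, norm_smul, mul_pow, Real.norm_eq_abs, sq_abs] at i2
    have : θ * (lam / 2 * (1 - θ) * ‖x - xs‖ ^ 2) ≤ θ * (F x - F xs) := by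
      nlinarith [mul_le_mul_of_nonneg_left i1 (by linarith : 0 ≤ 1 - θ),
        mul_le_mul_of_nonneg_left i2 h0.le]
    exact le_of_mul_le_mul_left this h0
  have hlim : Filter.Tendsto (fun θ : ℝ => lam / 2 * (1 - θ) * ‖x - xs‖ ^ 2)
      (nhdsWithin 0 (Set.Ioi 0)) (nhds (lam / 2 * (1 - 0) * ‖x - xs‖ ^ 2)) := by
    refine Filter.Tendsto.mono_left (Continuous.tendsto (by fun_prop) 0) nhdsWithin_le_nhds
  rw [sub_zero, mul_one] at hlim
  refine le_of_tendsto hlim ?_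
  filter_upwards [Ioo_mem_nhdsGT (zero_lt_one (α := ℝ))] with θ hθ using key θ hθ.1 hθ.2

/-- Strong convexity demands a quadratic term where bounded subgradients allow only linear
variation. This tension yields both the boundedness of `W` and the bound G²/(2λ) on the gap. -/
theorem sub_add_sq_le (hL : LipschitzOver F W G) (hS : StronglyConvexOver F W lam)
    (hsub : ∀ x ∈ W, (subdifferential F x).Nonempty) {x y : E} (hx : x ∈ W) (hy : y ∈ W) :
    F x - F y + lam / 2 * ‖x - y‖ ^ 2 ≤ G * ‖x - y‖ := by
  obtain ⟨g, hg⟩ := hsub x hx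
  have h1 := hS x hx y hy g hg
  have h2 := real_inner_le_norm g (x - y)
  have h3 := mul_le_mul_of_nonneg_right (hL x hx g hg) (norm_nonneg (x - y))
  rw [norm_sub_rev y x, ← neg_sub x y, inner_neg_right] at h1
  linarith

theorem norm_sub_sq_le_of_isMinOn (hc : Convex ℝ W) (hlam : 0 < lam) (hL : LipschitzOver F W G)
    (hS : StronglyConvexOver F W lam) (hsub : ∀ x ∈ W, (subdifferential F x).Nonempty)
    (hxs : xs ∈ W) (hmin : IsMinOn F W xs) {x : E} (hx : x ∈ W) :
    ‖x - xs‖ ^ 2 ≤ G ^ 2 / lam ^ 2 := by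
  have h1 := growth_of_isMinOn hc hS hsub hxs hmin hx
  have h2 := sub_add_sq_le hL hS hsub hx hxs
  have h3 : lam * ‖x - xs‖ ^ 2 ≤ G * ‖x - xs‖ := by linarith
  rw [le_div_iff₀ (by positivity)]
  have h4 : lam * ‖x - xs‖ ^ 2 * lam ≤ G * ‖x - xs‖ * lam := by gcongr
  nlinarith [sq_nonneg (G - lam * ‖x - xs‖)]

theorem sub_le_of_isMinOn (hlam : 0 < lam) (hL : LipschitzOver F W G)
    (hS : StronglyConvexOver F W lam) (hsub : ∀ x ∈ W, (subdifferential F x).Nonempty)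
    (hxs : xs ∈ W) {x : E} (hx : x ∈ W) : F x - F xs ≤ G ^ 2 / (2 * lam) := by
  have h2 := sub_add_sq_le hL hS hsub hx hxs
  rw [le_div_iff₀ (by positivity)]
  have h4 : (F x - F xs + lam / 2 * ‖x - xs‖ ^ 2) * (2 * lam) ≤ G * ‖x - xs‖ * (2 * lam) := by
    gcongr
  nlinarith [sq_nonneg (G - lam * ‖x - xs‖)]

variable [ProperSpace E]

/-- One step from `x`, measured by the squared distance to the minimizer. -/
theorem norm_step_sub_minimizer_sq_le (hW : IsClosed W) (hc : Convex ℝ W)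
    (hS : StronglyConvexOver F W lam) (hsub : ∀ x ∈ W, (subdifferential F x).Nonempty)
    (hxs : xs ∈ W) (hmin : IsMinOn F W xs) {x g : E} (hx : x ∈ W)
    (hg : g ∈ subdifferential F x) {a : ℝ} (ha : 0 ≤ a) (v : E) :
    ‖proj W (x - a • v) - xs‖ ^ 2
      ≤ (1 - 2 * lam * a) * ‖x - xs‖ ^ 2 + a ^ 2 * ‖v‖ ^ 2
        + inner ℝ (g - v) ((2 * a) • (x - xs)) := by
  have h1 := norm_proj_step_sq_le hW hc x v a hxs
  have h2 := growth_of_isMinOn hc hS hsub hxs hmin hx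
  have h3 := hS x hx xs hxs g hg
  rw [norm_sub_rev xs x, ← neg_sub x xs, inner_neg_right] at h3
  rw [real_inner_smul_right, inner_sub_left]
  -- One half of λ‖x - xs‖² comes from strong convexity at x, the other from quadratic growth at the
  -- minimizer.
  have h4 : 2 * a * (lam * ‖x - xs‖ ^ 2) ≤ 2 * a * inner ℝ g (x - xs) :=
    mul_le_mul_of_nonneg_left (by linarith) (by positivity)
  linarith

/-- The potential of the last-iterate analysis: `x` is the iterate, `y` the moving reference point
and `S` the sum of the remaining step sizes. -/
noncomputable def potential (F : E → ℝ) (xs : E) (S : ℝ) (x y : E) : ℝ :=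
  ‖x - y‖ ^ 2 / S + 2 * (F y - F xs)

/-- One step of the iterate and of its reference point, measured by the potential. -/
theorem potential_step_le (hF : ConvexOn ℝ Set.univ F) (hW : IsClosed W) (hc : Convex ℝ W)
    {x y g : E} (hx : x ∈ W) (hy : y ∈ W) (hg : g ∈ subdifferential F x) {a S : ℝ} (ha : 0 ≤ a)
    (hS : 0 < S) (v : E) :
    potential F xs S (proj W (x - a • v)) ((1 - a / (a + S)) • y + (a / (a + S)) • x)
      ≤ (1 - a / (a + S)) * (‖x - y‖ ^ 2 / (a + S)) + 2 * (F y - F xs) + a ^ 2 / S * ‖v‖ ^ 2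
        + inner ℝ (g - v) ((2 * (a / (a + S))) • (x - y)) := by
  have haS : 0 < a + S := by linarith
  set p := a / (a + S) with hp
  have hp0 : 0 ≤ p := by positivity
  have hp1 : 1 - p = S / (a + S) := by rw [hp]; field_simp; ring
  have hp1' : 0 ≤ 1 - p := by rw [hp1]; positivity
  have h1 := norm_proj_step_sq_le hW hc x v a (hc hy hx hp1' hp0 (by ring))
  have e : x - ((1 - p) • y + p • x) = (1 - p) • (x - y) := by module
  rw [e, real_inner_smul_right, norm_smul, mul_pow, Real.norm_eq_abs, sq_abs] at h1
  have h2 : F ((1 - p) • y + p • x) ≤ (1 - p) * F y + p * F x :=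
    hF.2 trivial trivial hp1' hp0 (by ring)
  have h3 := hg y
  rw [← neg_sub x y, inner_neg_right] at h3
  have h4 := mul_le_mul_of_nonneg_left h3 hp0
  unfold potential
  rw [real_inner_smul_right, inner_sub_left]
  have h5 := div_le_div_of_nonneg_right h1 hS.le
  -- The weight p = a/(a+S) is the one for which a(1 - p)/S = p, so the coefficient of the inner
  -- product matches the convexity estimate `h2` and F x drops out.
  have h6 : ((1 - p) ^ 2 * ‖x - y‖ ^ 2 - 2 * a * ((1 - p) * inner ℝ v (x - y)) + a ^ 2 * ‖v‖ ^ 2) / S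
      = (1 - p) * (‖x - y‖ ^ 2 / (a + S)) - 2 * p * inner ℝ v (x - y) + a ^ 2 / S * ‖v‖ ^ 2 := by
    rw [hp1, hp]; field_simp
  rw [h6] at h5
  linarith

omit [ProperSpace E] in
-- The passage from y back to x costs G‖x - y‖, which is split by the AM-GM inequality with weight
-- S.
theorem potential_last_le (hL : LipschitzOver F W G)
    (hsub : ∀ x ∈ W, (subdifferential F x).Nonempty) {x : E} (hx : x ∈ W) (y : E) {S : ℝ}
    (hS : 0 < S) : 2 * (F x - F xs) ≤ potential F xs S x y + G ^ 2 * S := by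
  have h := sub_le_of_lipschitzOver hL hsub hx y
  unfold potential
  have h2 : 2 * (G * ‖x - y‖) ≤ ‖x - y‖ ^ 2 / S + G ^ 2 * S := by
    have : ‖x - y‖ ^ 2 / S + G ^ 2 * S - 2 * (G * ‖x - y‖) = (‖x - y‖ - G * S) ^ 2 / S := by
      field_simp; ring
    have : 0 ≤ (‖x - y‖ - G * S) ^ 2 / S := by positivity
    linarith
  linarith

end Convexity

/-! ### Two-sided estimates of the step sizes and of their tail sums. -/

section StepSize

variable {T t : ℕ}

theorem phase_spec (ht : 1 ≤ t) :
    phase T t ≤ lastPhase T ∧ breakpoint T (phase T t) < t ∧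
      ∀ j, phase T t < j → j ≤ lastPhase T → t ≤ breakpoint T j := by
  classical
  unfold phase
  refine ⟨Nat.findGreatest_le _, ?_, fun j h1 h2 => not_lt.1 (Nat.findGreatest_is_greatest
    (P := fun i => breakpoint T i < t) h1 h2)⟩
  refine Nat.findGreatest_spec (P := fun i => breakpoint T i < t) (Nat.zero_le _) ?_
  simp [breakpoint]
  omega

theorem sub_lt_div_two_pow_phase (ht : 1 ≤ t) : (T : ℝ) - t < T / 2 ^ phase T t := by
  obtain ⟨h1, h2, -⟩ := phase_spec (T := T) ht
  rw [breakpoint, if_pos h1] at h2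
  by_contra! h
  rcases le_total T t with h3 | h3
  · have : (T : ℝ) ≤ t := by exact_mod_cast h3
    have : (0 : ℝ) < T / 2 ^ phase T t ∨ T = 0 := by
      rcases Nat.eq_zero_or_pos T with h4 | h4
      · exact Or.inr h4
      · exact Or.inl (by positivity)
    rcases this with h4 | h4
    · linarith
    · subst h4
      have : (1 : ℝ) ≤ t := by exact_mod_cast ht
      norm_num at h
      linarith
  · rw [← Nat.cast_sub h3] at h
    have := Nat.ceil_le.2 h
    omega

/-- In a phase i < k the next breakpoint is not yet passed, so T/2^(i+1) ≤ T - t; in the last phase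
T/2^k ≤ 1. -/
theorem one_div_two_pow_phase_le (ht : 1 ≤ t) (htT : t ≤ T) :
    1 / 2 ^ phase T t ≤ 2 * ((T : ℝ) + 1 - t) / T := by
  obtain ⟨h1, -, h3⟩ := phase_spec (T := T) ht
  have hT : (0 : ℝ) < T := by exact_mod_cast ht.trans htT
  have htT' : (t : ℝ) ≤ T := by exact_mod_cast htT
  suffices h : (T : ℝ) / 2 ^ phase T t ≤ 2 * ((T : ℝ) + 1 - t) by
    rw [le_div_iff₀ hT, one_div_mul_eq_div]; exact h
  rcases h1.eq_or_lt with h | h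
  · have : (T : ℝ) / 2 ^ lastPhase T ≤ 1 := by
      refine Nat.sInf_mem (s := {i : ℕ | (T : ℝ) / 2 ^ i ≤ 1}) ⟨T, ?_⟩
      rw [Set.mem_ofPred_eq, div_le_one (by positivity)]
      exact_mod_cast Nat.lt_two_pow_self.le
    rw [h]
    linarith
  · have h4 := h3 (phase T t + 1) (Nat.lt_succ_self _) h
    rw [breakpoint, if_pos (show phase T t + 1 ≤ lastPhase T from h)] at h4
    have h5 : ⌈(T : ℝ) / 2 ^ (phase T t + 1)⌉₊ ≤ T - t := by omega
    have h6 := Nat.ceil_le.1 h5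
    rw [Nat.cast_sub htT, pow_succ, ← div_div, div_le_iff₀ two_pos] at h6
    linarith

/-- For t < T the phase condition gives T - t < T/2^i, and T + 1 - t ≤ 2(T - t). At t = T the
minimality of k is needed: no phase has T/2^i ≤ 1/2. -/
theorem le_one_div_two_pow_phase (ht : 1 ≤ t) (htT : t ≤ T) :
    ((T : ℝ) + 1 - t) / (2 * T) ≤ 1 / 2 ^ phase T t := by
  have hT1 : (1 : ℝ) ≤ T := by exact_mod_cast ht.trans htT
  have hT : (0 : ℝ) < T := by linarith
  suffices h : (T : ℝ) + 1 - t ≤ 2 * (T / 2 ^ phase T t) by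
    rw [div_le_iff₀ (by positivity)]
    calc (T : ℝ) + 1 - t ≤ 2 * (T / 2 ^ phase T t) := h
      _ = 1 / 2 ^ phase T t * (2 * T) := by ring
  rcases htT.eq_or_lt with h | h
  · have : (1 : ℝ) / 2 < T / 2 ^ phase T t := by
      rcases Nat.eq_zero_or_pos (phase T t) with h0 | h0
      · rw [h0, pow_zero, div_one]; linarith
      · have h2 : phase T t - 1 < lastPhase T := by
          have := (phase_spec (T := T) ht).1
          omega
        have h3 := Nat.notMem_of_lt_sInf h2
        rw [Set.mem_ofPred_eq, not_le] at h3
        obtain ⟨j, hj⟩ : ∃ j, phase T t = j + 1 := ⟨phase T t - 1, by omega⟩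
        rw [hj, Nat.add_sub_cancel] at h3
        rw [hj, pow_succ, ← div_div]
        linarith
    rw [h]
    rw [h] at this
    linarith
  · have h1 := sub_lt_div_two_pow_phase (T := T) ht
    have h2 : (t : ℝ) + 1 ≤ T := by exact_mod_cast h
    linarith

theorem phase_eq_zero (ht : 1 ≤ t) (htT : 2 * t ≤ T) : phase T t = 0 := by
  by_contra h
  have h1 := sub_lt_div_two_pow_phase (T := T) ht
  have h2 : (2 : ℝ) ^ 1 ≤ 2 ^ phase T t := pow_le_pow_right₀ one_le_two (by omega)
  have h3 : (T : ℝ) / 2 ^ phase T t ≤ T / 2 ^ 1 := by gcongr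
  have h4 : (2 : ℝ) * t ≤ T := by exact_mod_cast htT
  rw [pow_one] at h3
  linarith

variable {lam : ℝ}

theorem stepSize_pos (hlam : 0 < lam) (ht : 1 ≤ t) : 0 < stepSize lam T t := by
  have : (0 : ℝ) < t := by exact_mod_cast ht
  unfold stepSize
  positivity

theorem stepSize_early (ht : 1 ≤ t) (htT : 2 * t ≤ T) : stepSize lam T t = 1 / (lam * t) := by
  rw [stepSize, phase_eq_zero ht htT, pow_zero, div_one, one_mul]

theorem le_stepSize (hlam : 0 < lam) (ht : 1 ≤ t) (htT : t ≤ T) :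
    ((T : ℝ) + 1 - t) / (2 * lam * T ^ 2) ≤ stepSize lam T t := by
  have h0 : (0 : ℝ) < t := by exact_mod_cast ht
  have h1 : (t : ℝ) ≤ T := by exact_mod_cast htT
  have hT : (0 : ℝ) < T := by linarith
  have h2 : 1 / (lam * T) ≤ 1 / (lam * t) := by gcongr
  calc ((T : ℝ) + 1 - t) / (2 * lam * T ^ 2) = (T + 1 - t) / (2 * T) * (1 / (lam * T)) := by
        field_simp
    _ ≤ 1 / 2 ^ phase T t * (1 / (lam * t)) :=
        mul_le_mul (le_one_div_two_pow_phase ht htT) h2 (by positivity) (by positivity)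

theorem stepSize_le_of_lt (hlam : 0 < lam) (ht : T < 2 * t) (htT : t ≤ T) :
    stepSize lam T t ≤ 4 * ((T : ℝ) + 1 - t) / (lam * T ^ 2) := by
  have h0 : (0 : ℝ) < t := by exact_mod_cast (by omega : 0 < t)
  have h1 : (t : ℝ) ≤ T := by exact_mod_cast htT
  have hT : (0 : ℝ) < T := by linarith
  have h3 : (T : ℝ) < 2 * t := by exact_mod_cast ht
  have h2 : 1 / (lam * t) ≤ 1 / (lam * (T / 2)) := by gcongr; linarith
  calc stepSize lam T t ≤ 2 * ((T : ℝ) + 1 - t) / T * (1 / (lam * (T / 2))) :=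
        mul_le_mul (one_div_two_pow_phase_le (by omega) htT) h2 (by positivity)
          (div_nonneg (by linarith) hT.le)
    _ = 4 * ((T : ℝ) + 1 - t) / (lam * T ^ 2) := by field_simp; ring

theorem stepSize_le_two_div (hlam : 0 < lam) (ht : T < 2 * t) (hT : 1 ≤ T) :
    stepSize lam T t ≤ 2 / (lam * T) := by
  have hT : (0 : ℝ) < T := by exact_mod_cast hT
  have h3 : (T : ℝ) < 2 * t := by exact_mod_cast ht
  have h2 : 1 / (lam * t) ≤ 1 / (lam * (T / 2)) := by gcongr; linarith
  have h4 : (1 : ℝ) / 2 ^ phase T t ≤ 1 := by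
    rw [div_le_one (by positivity)]
    exact one_le_pow₀ one_le_two
  calc stepSize lam T t ≤ 1 * (1 / (lam * (T / 2))) :=
        mul_le_mul h4 h2 (by have : (0 : ℝ) < t := by linarith
                             positivity) zero_le_one
    _ = 2 / (lam * T) := by field_simp

/-- The sum of the step sizes from time `t` on. -/
noncomputable def remaining (lam : ℝ) (T t : ℕ) : ℝ :=
  ∑ u ∈ Finset.Icc t T, stepSize lam T u

theorem remaining_self : remaining lam T T = stepSize lam T T := by
  simp [remaining]

theorem remaining_eq_add (htT : t ≤ T) :
    remaining lam T t = stepSize lam T t + remaining lam T (t + 1) := by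
  rw [remaining, ← Finset.insert_Icc_add_one_left_eq_Icc htT, Finset.sum_insert (by simp)]
  rfl

/-- The lower bounds `le_stepSize` are linear in T + 1 - t and sum to a triangular number. -/
theorem le_remaining (hlam : 0 < lam) (ht : 1 ≤ t) (htT : t ≤ T) :
    ((T : ℝ) + 1 - t) * (T + 2 - t) / (4 * lam * T ^ 2) ≤ remaining lam T t := by
  have hT : (0 : ℝ) < T := by exact_mod_cast ht.trans htT
  induction htT using Nat.decreasingInduction with
  | self =>
    rw [remaining_self]
    refine le_trans (le_of_eq ?_) (le_stepSize hlam ht le_rfl)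
    field_simp
    ring
  | of_succ t htT ih =>
    rw [remaining_eq_add htT.le]
    refine le_trans (le_of_eq ?_) (add_le_add (le_stepSize hlam ht htT.le) (ih (by omega)))
    push_cast
    field_simp
    ring

theorem remaining_pos (hlam : 0 < lam) (ht : 1 ≤ t) (htT : t ≤ T) : 0 < remaining lam T t :=
  Finset.sum_pos (fun _ hu => stepSize_pos hlam (ht.trans (Finset.mem_Icc.1 hu).1))
    ⟨t, Finset.mem_Icc.2 ⟨le_rfl, htT⟩⟩

/-- Up to powers of λ and T, the ratio is 16(T+1-t)² over (T-t)(T+1-t)/4. It is at most 128 because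
T + 1 - t ≤ 2(T - t), which is where t < T enters. -/
theorem sq_stepSize_div_remaining_le (hlam : 0 < lam) (ht : T < 2 * t) (htT : t < T) :
    stepSize lam T t ^ 2 / remaining lam T (t + 1) ≤ 128 / (lam * T ^ 2) := by
  have hT : (0 : ℝ) < T := by exact_mod_cast (by omega : 0 < T)
  have h0 : (t : ℝ) + 1 ≤ T := by exact_mod_cast htT
  have h1 := stepSize_le_of_lt hlam ht htT.le
  have h2 := le_remaining (lam := lam) hlam (by omega : 1 ≤ t + 1) htT
  push_cast at h2
  rw [div_le_iff₀ (remaining_pos hlam (by omega) htT)]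
  have hp := (stepSize_pos (T := T) hlam (by omega : 1 ≤ t)).le
  calc stepSize lam T t ^ 2 ≤ (4 * ((T : ℝ) + 1 - t) / (lam * T ^ 2)) ^ 2 := by gcongr
    _ ≤ 128 / (lam * T ^ 2) * (((T : ℝ) + 1 - (t + 1)) * (T + 2 - (t + 1)) / (4 * lam * T ^ 2)) := by
        have e1 : (4 * ((T : ℝ) + 1 - t) / (lam * T ^ 2)) ^ 2
          = 16 * (T + 1 - t) ^ 2 / (lam ^ 2 * T ^ 4) := by field_simp; ring
        have e2 : 128 / (lam * T ^ 2)
            * (((T : ℝ) + 1 - (t + 1)) * (T + 2 - (t + 1)) / (4 * lam * T ^ 2))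
          = 32 * ((T - t) * (T + 1 - t)) / (lam ^ 2 * T ^ 4) := by field_simp; ring
        rw [e1, e2]
        gcongr ?_ / _
        nlinarith
    _ ≤ _ := by gcongr

theorem one_div_le_remaining (hlam : 0 < lam) (hT : 1 ≤ T) :
    1 / (16 * lam) ≤ remaining lam T (T / 2 + 1) := by
  refine le_trans ?_ (le_remaining hlam (by omega) (by omega))
  have h1 : (0 : ℝ) < T := by exact_mod_cast hT
  have h2 : ((T / 2 : ℕ) : ℝ) ≤ T / 2 := Nat.cast_div_le
  rw [div_le_div_iff₀ (by positivity) (by positivity)]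
  push_cast
  nlinarith [mul_pos hlam h1, mul_nonneg hlam.le (sub_nonneg.2 h2)]

end StepSize

/-! ### Scalar recursions shared by GD and SGD. -/

section Recursion

variable {T : ℕ} {lam G : ℝ}

/-- The distance recursion with step sizes `1 / (lam t)` gives decay `1 / t`. -/
theorem sq_dist_recursion (hlam : 0 < lam) {d : ℕ → ℝ} (hd0 : ∀ t, 0 ≤ d t)
    (hd1 : d 1 ≤ G ^ 2 / lam ^ 2)
    (hd : ∀ t, 1 ≤ t → 2 * t ≤ T → d (t + 1)
      ≤ (1 - 2 * lam * stepSize lam T t) * d t + stepSize lam T t ^ 2 * G ^ 2)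
    {t : ℕ} (ht : 1 ≤ t) (htT : t ≤ T / 2 + 1) : d t ≤ 2 * G ^ 2 / (lam ^ 2 * t) := by
  induction t, ht using Nat.le_induction with
  | base =>
    refine hd1.trans ?_
    rw [Nat.cast_one, mul_one]
    gcongr
    nlinarith [sq_nonneg G]
  | succ t ht ih =>
    have h := hd t ht (by omega)
    have h0 : (0 : ℝ) < t := by exact_mod_cast ht
    rw [stepSize_early ht (by omega)] at h
    have e1 : 2 * lam * (1 / (lam * t)) = 2 / t := by field_simp
    have e2 : (1 / (lam * (t : ℝ))) ^ 2 * G ^ 2 = G ^ 2 / lam ^ 2 * (1 / t ^ 2) := by field_simp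
    rw [e1, e2] at h
    refine h.trans ?_
    have e3 : 2 * G ^ 2 / (lam ^ 2 * ((t + 1 : ℕ) : ℝ)) = G ^ 2 / lam ^ 2 * (2 / (t + 1)) := by
      push_cast; field_simp
    rw [e3]
    have hG : 0 ≤ G ^ 2 / lam ^ 2 := by positivity
    -- At t = 1 the factor 1 - 2/t is -1, so an upper bound on `d 1` is of no use; its nonnegativity
    -- suffices.
    rcases ht.eq_or_lt with h1 | h1
    · subst h1
      have := hd0 1
      norm_num
      linarith
    · have h2 : (2 : ℝ) ≤ t := by exact_mod_cast h1
      have ih' := ih (by omega)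
      have e4 : 2 * G ^ 2 / (lam ^ 2 * (t : ℝ)) = G ^ 2 / lam ^ 2 * (2 / t) := by field_simp
      rw [e4] at ih'
      have h3 : 0 ≤ 1 - 2 / (t : ℝ) := by rw [sub_nonneg, div_le_one h0]; exact h2
      calc (1 - 2 / (t : ℝ)) * d t + G ^ 2 / lam ^ 2 * (1 / t ^ 2)
          ≤ (1 - 2 / (t : ℝ)) * (G ^ 2 / lam ^ 2 * (2 / t)) + G ^ 2 / lam ^ 2 * (1 / t ^ 2) := by
            gcongr
        _ = G ^ 2 / lam ^ 2 * ((1 - 2 / (t : ℝ)) * (2 / t) + 1 / t ^ 2) := by ring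
        _ ≤ G ^ 2 / lam ^ 2 * (2 / (t + 1)) := by
            gcongr
            rw [show (1 - 2 / (t : ℝ)) * (2 / t) + 1 / t ^ 2 = (2 * t - 3) / t ^ 2 by field_simp; ring,
              div_le_div_iff₀ (by positivity) (by positivity)]
            nlinarith

/-- A sequence growing by at most `c` in each of the steps of the second half of `[1, T]`. -/
theorem le_add_mul_of_late_step {P : ℕ → ℝ} {c : ℝ}
    (hP : ∀ t, T < 2 * t → t < T → P (t + 1) ≤ P t + c)
    {t : ℕ} (ht : T / 2 + 1 ≤ t) (htT : t ≤ T) :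
    P t ≤ P (T / 2 + 1) + ((t : ℝ) - (T / 2 + 1 : ℕ)) * c := by
  induction t, ht using Nat.le_induction with
  | base => simp
  | succ t ht ih =>
    have h := hP t (by omega) (by omega)
    have := ih (by omega)
    push_cast at this ⊢
    linarith

/-- In units of G²/(λT), the potential is at most 64 at the midpoint, grows by at most 64, and the
final comparison costs 2. The sequences `d` and `P` are the actual quantities for GD and their
expectations for SGD. -/
theorem last_iterate_recursion (hlam : 0 < lam) (hT : 1 ≤ T) {d P : ℕ → ℝ} {a : ℝ}
    (hd0 : ∀ t, 0 ≤ d t) (hd1 : d 1 ≤ G ^ 2 / lam ^ 2)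
    (hd : ∀ t, 1 ≤ t → 2 * t ≤ T → d (t + 1)
      ≤ (1 - 2 * lam * stepSize lam T t) * d t + stepSize lam T t ^ 2 * G ^ 2)
    (hdP : P (T / 2 + 1) ≤ d (T / 2 + 1) / remaining lam T (T / 2 + 1))
    (hP : ∀ t, T < 2 * t → t < T →
      P (t + 1) ≤ P t + stepSize lam T t ^ 2 / remaining lam T (t + 1) * G ^ 2)
    (ha : 2 * a ≤ P T + G ^ 2 * remaining lam T T) : a ≤ 130 * G ^ 2 / (lam * T) := by
  have hT0 : (0 : ℝ) < T := by exact_mod_cast hT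
  have h1 := sq_dist_recursion hlam hd0 hd1 hd (t := T / 2 + 1) (by omega) le_rfl
  have hn : (T : ℝ) / 2 ≤ ((T / 2 + 1 : ℕ) : ℝ) := by
    have : T ≤ 2 * (T / 2 + 1) := by omega
    have : (T : ℝ) ≤ 2 * ((T / 2 + 1 : ℕ) : ℝ) := by exact_mod_cast this
    linarith
  have h2 : d (T / 2 + 1) / remaining lam T (T / 2 + 1) ≤ 64 * (G ^ 2 / (lam * T)) := by
    calc d (T / 2 + 1) / remaining lam T (T / 2 + 1)
        ≤ (2 * G ^ 2 / (lam ^ 2 * (T / 2))) / (1 / (16 * lam)) := by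
          gcongr
          · exact h1.trans (by gcongr)
          · exact one_div_le_remaining hlam hT
      _ = 64 * (G ^ 2 / (lam * T)) := by field_simp; ring
  have h3 := le_add_mul_of_late_step (c := 128 / (lam * T ^ 2) * G ^ 2)
    (fun t h h' => (hP t h h').trans (add_le_add le_rfl
      (mul_le_mul_of_nonneg_right (sq_stepSize_div_remaining_le hlam h h') (sq_nonneg G))))
    (t := T) (by omega) le_rfl
  have h4 : ((T : ℝ) - (T / 2 + 1 : ℕ)) * (128 / (lam * T ^ 2) * G ^ 2)
      ≤ 64 * (G ^ 2 / (lam * T)) := by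
    calc ((T : ℝ) - (T / 2 + 1 : ℕ)) * (128 / (lam * T ^ 2) * G ^ 2)
        ≤ (T / 2) * (128 / (lam * T ^ 2) * G ^ 2) := by
          gcongr; linarith
      _ = 64 * (G ^ 2 / (lam * T)) := by field_simp; ring
  have h5 : G ^ 2 * remaining lam T T ≤ 2 * (G ^ 2 / (lam * T)) := by
    rw [remaining_self]
    calc G ^ 2 * stepSize lam T T ≤ G ^ 2 * (2 / (lam * T)) := by
          gcongr; exact stepSize_le_two_div hlam (by omega) hT
      _ = 2 * (G ^ 2 / (lam * T)) := by ring
  have h6 : 0 ≤ G ^ 2 / (lam * T) := by positivity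
  rw [mul_div_assoc]
  linarith

end Recursion

/-! ### Reference points and basic facts on the iterates. -/

section References

variable {E : Type*} [NormedAddCommGroup E] [InnerProductSpace ℝ E] {W : Set E} {lam : ℝ} {T : ℕ}

/-- The weight of the current iterate in the update of the reference point: the reference point is
at rest during the first half of the steps. -/
noncomputable def refWeight (lam : ℝ) (T t : ℕ) : ℝ :=
  if 2 * t ≤ T then 0 else stepSize lam T t / remaining lam T t

theorem refWeight_mem (hlam : 0 < lam) {t : ℕ} (htT : t < T) :
    0 ≤ refWeight lam T t ∧ refWeight lam T t ≤ 1 := by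
  unfold refWeight
  split_ifs with h
  · simp
  · have h1 := stepSize_pos (T := T) hlam (by omega : 1 ≤ t)
    have h2 := remaining_pos hlam (by omega : 1 ≤ t + 1) htT
    rw [remaining_eq_add htT.le]
    exact ⟨by positivity, (div_le_one (by positivity)).2 (by linarith)⟩

/-- The reference points, moving towards the iterates `x`. -/
noncomputable def refPoint (p : ℕ → ℝ) (x : ℕ → E) (y₀ : E) : ℕ → E
  | 0 => y₀
  | t + 1 => (1 - p t) • refPoint p x y₀ t + p t • x t

theorem refPoint_mem (hc : Convex ℝ W) (hlam : 0 < lam) {x : ℕ → E} (hx : ∀ t, x t ∈ W) {y₀ : E}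
    (hy : y₀ ∈ W) {t : ℕ} (htT : t ≤ T) : refPoint (refWeight lam T) x y₀ t ∈ W := by
  induction t with
  | zero => exact hy
  | succ t ih =>
    obtain ⟨h0, h1⟩ := refWeight_mem hlam (Nat.lt_of_succ_le htT)
    exact hc (ih (by omega)) (hx t) (by linarith) h0 (by ring)

theorem refPoint_early (x : ℕ → E) (y₀ : E) {t : ℕ} (ht : t ≤ T / 2 + 1) :
    refPoint (refWeight lam T) x y₀ t = y₀ := by
  induction t with
  | zero => rfl
  | succ t ih => simp [refPoint, ih (by omega), refWeight, show 2 * t ≤ T by omega]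

theorem refPoint_late (x : ℕ → E) (y₀ : E) {t : ℕ} (ht : T < 2 * t) (htT : t < T) :
    refPoint (refWeight lam T) x y₀ (t + 1)
      = (1 - stepSize lam T t / (stepSize lam T t + remaining lam T (t + 1)))
          • refPoint (refWeight lam T) x y₀ t
        + (stepSize lam T t / (stepSize lam T t + remaining lam T (t + 1))) • x t := by
  rw [← remaining_eq_add htT.le]
  simp [refPoint, refWeight, not_le.2 ht]

theorem iterate_mem [ProperSpace E] (hW : IsClosed W) (α : ℕ → ℝ) (g : ℕ → E → E) {x₁ : E}
    (hx : x₁ ∈ W) (t : ℕ) : iterate W α g x₁ t ∈ W := by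
  match t with
  | 0 => exact hx
  | 1 => exact hx
  | t + 2 => exact (proj_spec hW ⟨x₁, hx⟩ _).1

theorem iterate_succ (α : ℕ → ℝ) (g : ℕ → E → E) (x₁ : E) {t : ℕ} (ht : 1 ≤ t) :
    iterate W α g x₁ (t + 1)
      = proj W (iterate W α g x₁ t - α t • g t (iterate W α g x₁ t)) := by
  obtain ⟨s, rfl⟩ : ∃ s, t = s + 1 := ⟨t - 1, by omega⟩
  rfl

end References

/-! ### The deterministic bound. -/

section GradientDescent

variable {E : Type*} [NormedAddCommGroup E] [InnerProductSpace ℝ E] [ProperSpace E] {F : E → ℝ}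
  {W : Set E} {G lam : ℝ} {xs x₁ : E} {T : ℕ}

theorem gradientDescent_last_iterate_le (hF : ConvexOn ℝ Set.univ F) (hW : IsClosed W)
    (hc : Convex ℝ W) (hL : LipschitzOver F W G) (hlam : 0 < lam) (hS : StronglyConvexOver F W lam)
    (hxs : xs ∈ W) (hmin : IsMinOn F W xs) (hT : 1 ≤ T) (hx₁ : x₁ ∈ W) {g : ℕ → E → E}
    (hg : ∀ t ∈ Set.Icc 1 T, ∀ x ∈ W, g t x ∈ subdifferential F x) :
    F (iterate W (stepSize lam T) g x₁ T) ≤ F xs + 130 * G ^ 2 / (lam * T) := by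
  have hsub : ∀ x ∈ W, (subdifferential F x).Nonempty := fun x hx => ⟨_, hg 1 ⟨le_rfl, hT⟩ x hx⟩
  set x := iterate W (stepSize lam T) g x₁ with hxdef
  have hx : ∀ t, x t ∈ W := iterate_mem hW _ _ hx₁
  set y := refPoint (refWeight lam T) x xs with hydef
  have hgn : ∀ t, 1 ≤ t → t ≤ T → ‖g t (x t)‖ ≤ G := fun t h1 h2 =>
    hL _ (hx t) _ (hg t ⟨h1, h2⟩ _ (hx t))
  rw [← sub_le_iff_le_add']
  refine last_iterate_recursion hlam hT (d := fun t => ‖x t - xs‖ ^ 2)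
    (P := fun t => potential F xs (remaining lam T t) (x t) (y t)) (fun t => sq_nonneg _)
    (norm_sub_sq_le_of_isMinOn hc hlam hL hS hsub hxs hmin (hx 1)) (fun t h1 h2 => ?_) ?_
    (fun t h1 h2 => ?_) (potential_last_le hL hsub (hx T) _ (remaining_pos hlam hT le_rfl))
  · have h := norm_step_sub_minimizer_sq_le hW hc hS hsub hxs hmin (hx t)
      (hg t ⟨h1, by omega⟩ _ (hx t)) (stepSize_pos (T := T) hlam h1).le (g t (x t))
    rw [sub_self, inner_zero_left, add_zero] at h
    simp only [hxdef, iterate_succ _ _ _ h1] at h ⊢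
    exact h.trans (by gcongr; exact hgn t h1 (by omega))
  · simp only [hydef, refPoint_early x xs le_rfl, potential, sub_self, mul_zero, add_zero, le_refl]
  · have hy : y t ∈ W := refPoint_mem hc hlam hx hxs h2.le
    have hS' := remaining_pos hlam (by omega : 1 ≤ t + 1) h2
    have ha := stepSize_pos (T := T) hlam (by omega : 1 ≤ t)
    have h := potential_step_le hF hW hc (xs := xs) (hx t) hy
      (hg t ⟨by omega, h2.le⟩ _ (hx t)) ha.le hS' (g t (x t))
    rw [sub_self, inner_zero_left, add_zero, ← refPoint_late x xs h1 h2] at h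
    have e : x (t + 1) = proj W (x t - stepSize lam T t • g t (x t)) :=
      iterate_succ _ _ _ (by omega)
    rw [← e] at h
    refine h.trans ?_
    have h3 := hgn t (by omega) h2.le
    have h4 : stepSize lam T t ^ 2 / remaining lam T (t + 1) * ‖g t (x t)‖ ^ 2
        ≤ stepSize lam T t ^ 2 / remaining lam T (t + 1) * G ^ 2 := by gcongr
    have h5 : 0 ≤ stepSize lam T t / (stepSize lam T t + remaining lam T (t + 1))
        * (‖x t - y t‖ ^ 2 / (stepSize lam T t + remaining lam T (t + 1))) := by positivity
    simp only [potential, remaining_eq_add h2.le]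
    linarith

end GradientDescent

/-! ### Averaging over the noise of a single step. -/

section OneStep

variable {E : Type*} [NormedAddCommGroup E] [InnerProductSpace ℝ E] [FiniteDimensional ℝ E]
  [MeasurableSpace E] [BorelSpace E] {Ω : Type*} [MeasurableSpace Ω] {μ : Measure Ω}
  [IsProbabilityMeasure μ] {V : Ω → E} {G : ℝ}

omit [MeasurableSpace E] [BorelSpace E] in
theorem integral_inner_centered (hV : Integrable V μ) (w : E) :
    ∫ ω, inner ℝ ((∫ ω', V ω' ∂μ) - V ω) w ∂μ = 0 := by
  have h : Integrable (fun ω => (∫ ω', V ω' ∂μ) - V ω) μ := (integrable_const _).sub hV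
  simp_rw [real_inner_comm w]
  rw [integral_inner h, integral_sub (integrable_const _) hV]
  simp

theorem integrable_of_norm_le (hV : Measurable V) (hG : ∀ᵐ ω ∂μ, ‖V ω‖ ≤ G) : Integrable V μ :=
  Integrable.of_bound hV.aestronglyMeasurable G hG

/-- The mean of a quantity controlled by a bounded random direction. -/
theorem integral_le_of_step (hV : Measurable V) (hG : ∀ᵐ ω ∂μ, ‖V ω‖ ≤ G) {Y : Ω → ℝ}
    (hY0 : ∀ ω, 0 ≤ Y ω) {A c : ℝ} (hc : 0 ≤ c) (w : E)
    (hY : ∀ ω, Y ω ≤ A + c * ‖V ω‖ ^ 2 + inner ℝ ((∫ ω', V ω' ∂μ) - V ω) w) :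
    ∫ ω, Y ω ∂μ ≤ A + c * G ^ 2 := by
  have hVi := integrable_of_norm_le hV hG
  have hi : Integrable (fun ω => inner ℝ ((∫ ω', V ω' ∂μ) - V ω) w) μ :=
    ((integrable_const _).sub hVi).inner_const w
  calc ∫ ω, Y ω ∂μ ≤ ∫ ω, (A + c * G ^ 2 + inner ℝ ((∫ ω', V ω' ∂μ) - V ω) w) ∂μ := by
        refine integral_mono_of_nonneg (ae_of_all _ hY0) ((integrable_const _).add hi) ?_
        filter_upwards [hG] with ω hω
        refine (hY ω).trans ?_
        gcongr
    _ = A + c * G ^ 2 := by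
        rw [integral_add (integrable_const _) hi, integral_inner_centered hVi]
        simp

/-- The exponential moment of a quantity controlled by a bounded random direction. -/
theorem integral_exp_le_of_step (hV : Measurable V) (hG : ∀ᵐ ω ∂μ, ‖V ω‖ ≤ G) {Y : Ω → ℝ}
    {A c θ : ℝ} (hc : 0 ≤ c) (hθ : 0 ≤ θ) (w : E)
    (hY : ∀ ω, Y ω ≤ A + c * ‖V ω‖ ^ 2 + inner ℝ ((∫ ω', V ω' ∂μ) - V ω) w) :
    ∫ ω, Real.exp (θ * Y ω) ∂μ
      ≤ Real.exp (θ * (A + c * G ^ 2) + θ ^ 2 * (G ^ 2 * ‖w‖ ^ 2) / 2) := by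
  have hVi := integrable_of_norm_le hV hG
  -- Hoeffding's lemma: ⟨V, w⟩ lies in an interval of length 2G‖w‖, hence the variance proxy G²‖w‖².
  have hsg := hasSubgaussianMGF_of_mem_Icc (μ := μ) (X := fun ω => - inner ℝ (V ω) w)
    (a := -(G * ‖w‖)) (b := G * ‖w‖) (hV.inner_const.neg.aemeasurable) (by
      filter_upwards [hG] with ω hω
      have h := (abs_real_inner_le_norm (V ω) w).trans
        (mul_le_mul_of_nonneg_right hω (norm_nonneg w))
      obtain ⟨h1, h2⟩ := abs_le.1 h
      exact ⟨by linarith, by linarith⟩)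
  have e : ∀ ω, - inner ℝ (V ω) w - ∫ ω', - inner ℝ (V ω') w ∂μ
      = inner ℝ ((∫ ω', V ω' ∂μ) - V ω) w := by
    intro ω
    have : ∫ ω', inner ℝ (V ω') w ∂μ = inner ℝ (∫ ω', V ω' ∂μ) w := by
      simp_rw [real_inner_comm w]
      exact integral_inner hVi w
    rw [integral_neg, this, inner_sub_left]
    ring
  simp_rw [e] at hsg
  have hm := hsg.mgf_le θ
  rw [mgf] at hm
  have e2 : (((‖G * ‖w‖ - -(G * ‖w‖)‖₊ / 2) ^ 2 : NNReal) : ℝ) = G ^ 2 * ‖w‖ ^ 2 := by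
    push_cast
    rw [Real.norm_eq_abs, div_pow, sq_abs]
    ring
  rw [e2] at hm
  calc ∫ ω, Real.exp (θ * Y ω) ∂μ
      ≤ ∫ ω, Real.exp (θ * (A + c * G ^ 2))
          * Real.exp (θ * inner ℝ ((∫ ω', V ω' ∂μ) - V ω) w) ∂μ := by
        refine integral_mono_of_nonneg (ae_of_all _ fun ω => (Real.exp_pos _).le)
          ((hsg.integrable_exp_mul θ).const_mul _) ?_
        filter_upwards [hG] with ω hω
        rw [← Real.exp_add, ← mul_add]
        refine Real.exp_le_exp.2 (mul_le_mul_of_nonneg_left ((hY ω).trans ?_) hθ)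
        gcongr
    _ ≤ Real.exp (θ * (A + c * G ^ 2)) * Real.exp (G ^ 2 * ‖w‖ ^ 2 * θ ^ 2 / 2) := by
        rw [integral_const_mul]
        gcongr
    _ = _ := by
        rw [← Real.exp_add]
        congr 1
        ring

/-- Integration over an independent noise, one value of the state at a time. -/
theorem integral_le_of_indepFun {β Ξ : Type*} [MeasurableSpace β] [MeasurableSpace Ξ]
    {Z : Ω → β} {N : Ω → Ξ} (hZ : Measurable Z) (hN : Measurable N) (hind : IndepFun Z N μ)
    {K : Set β} (hK : MeasurableSet K) (hZK : ∀ ω, Z ω ∈ K) {Φ : β → Ξ → ℝ} {Ψ : β → ℝ}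
    (hΦ : Measurable (Function.uncurry Φ)) (hΨ : Measurable Ψ) (hΦ0 : ∀ z ∈ K, ∀ e, 0 ≤ Φ z e)
    (hΨi : Integrable (fun ω => Ψ (Z ω)) μ) (h : ∀ z ∈ K, ∫ ω, Φ z (N ω) ∂μ ≤ Ψ z) :
    ∫ ω, Φ (Z ω) (N ω) ∂μ ≤ ∫ ω, Ψ (Z ω) ∂μ := by
  have hprod := (indepFun_iff_map_prod_eq_prod_map_map hZ.aemeasurable hN.aemeasurable).1 hind
  have : IsProbabilityMeasure (μ.map Z) := Measure.isProbabilityMeasure_map hZ.aemeasurable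
  have : IsProbabilityMeasure (μ.map N) := Measure.isProbabilityMeasure_map hN.aemeasurable
  have hae : ∀ᵐ z ∂(μ.map Z), z ∈ K :=
    (ae_map_iff hZ.aemeasurable hK).2 (ae_of_all _ hZK)
  have hinner : ∀ z, ∫ ω, Φ z (N ω) ∂μ = ∫ e, Φ z e ∂(μ.map N) := fun z =>
    (integral_map hN.aemeasurable
      (hΦ.comp measurable_prodMk_left).aestronglyMeasurable).symm
  by_cases hi : Integrable (fun ω => Φ (Z ω) (N ω)) μ
  · have hi2 : Integrable (Function.uncurry Φ) ((μ.map Z).prod (μ.map N)) := by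
      rw [← hprod]
      exact (integrable_map_measure hΦ.aestronglyMeasurable (hZ.prodMk hN).aemeasurable).2 hi
    calc ∫ ω, Φ (Z ω) (N ω) ∂μ
        = ∫ q, Function.uncurry Φ q ∂(μ.map fun ω => (Z ω, N ω)) :=
          (integral_map (hZ.prodMk hN).aemeasurable hΦ.aestronglyMeasurable).symm
      _ = ∫ z, ∫ e, Φ z e ∂(μ.map N) ∂(μ.map Z) := by
          rw [hprod, integral_prod _ hi2]
          rfl
      _ ≤ ∫ z, Ψ z ∂(μ.map Z) := by
          refine integral_mono_of_nonneg ?_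
            ((integrable_map_measure hΨ.aestronglyMeasurable hZ.aemeasurable).2 hΨi) ?_
          · filter_upwards [hae] with z hz using integral_nonneg (hΦ0 z hz)
          · filter_upwards [hae] with z hz
            rw [← hinner]
            exact h z hz
      _ = ∫ ω, Ψ (Z ω) ∂μ := integral_map hZ.aemeasurable hΨ.aestronglyMeasurable
  -- Without integrability the left side is 0 by convention, while Ψ is nonnegative on K because it
  -- dominates integrals of nonnegative functions.
  · rw [integral_undef hi]
    exact integral_nonneg fun ω =>
      (integral_nonneg fun ω' => hΦ0 _ (hZK ω) _).trans (h _ (hZK ω))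

end OneStep

/-! ### Measurability, independence and integrability of the SGD state. -/

section SGD

variable {E : Type*} [NormedAddCommGroup E] [InnerProductSpace ℝ E] [FiniteDimensional ℝ E]
  [MeasurableSpace E] [BorelSpace E] {Ω : Type*} [mΩ : MeasurableSpace Ω] {μ : Measure Ω}
  [IsProbabilityMeasure μ] {Ξ : ℕ → Type*} [∀ t, MeasurableSpace (Ξ t)] {F : E → ℝ} {W : Set E}
  {G lam : ℝ} {T : ℕ} {ξ : ∀ t, Ω → Ξ t} {h : ∀ t, Ξ t → E → E} {xs x₁ : E}

/-- The σ-algebra generated by the noise before time `t`. -/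
abbrev past (ξ : ∀ t, Ω → Ξ t) (T t : ℕ) : MeasurableSpace Ω :=
  ⨆ s ∈ {s : Set.Icc 1 T | (s : ℕ) < t}, MeasurableSpace.comap (ξ s) inferInstance

omit mΩ in
theorem past_mono {s t : ℕ} (hst : s ≤ t) : past ξ T s ≤ past ξ T t :=
  biSup_mono fun _ hu => lt_of_lt_of_le hu hst

omit mΩ in
theorem measurable_noise_past {t : ℕ} (ht : t ∈ Set.Icc 1 T) :
    Measurable[past ξ T (t + 1)] (ξ t) :=
  measurable_iff_comap_le.2 (le_biSup
    (fun s : Set.Icc 1 T => MeasurableSpace.comap (ξ s) inferInstance)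
    (show (⟨t, ht⟩ : Set.Icc 1 T) ∈ {s : Set.Icc 1 T | (s : ℕ) < t + 1} from Nat.lt_succ_self t))

omit [FiniteDimensional ℝ E] [BorelSpace E] [IsProbabilityMeasure μ] in
theorem past_le (hO : IsStochasticOracle μ F W G T ξ h) (t : ℕ) : past ξ T t ≤ mΩ :=
  iSup₂_le fun s _ => (hO.measurable_noise s s.2).comap_le

omit [FiniteDimensional ℝ E] [BorelSpace E] [IsProbabilityMeasure μ] in
theorem indep_past (hO : IsStochasticOracle μ F W G T ξ h) {t : ℕ} (ht : t ∈ Set.Icc 1 T) :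
    Indep (past ξ T t) (MeasurableSpace.comap (ξ t) inferInstance) μ := by
  have hdis : Disjoint {s : Set.Icc 1 T | (s : ℕ) < t} {⟨t, ht⟩} := by
    rw [Set.disjoint_singleton_right]
    exact lt_irrefl t
  have := indep_iSup_of_disjoint (μ := μ)
    (m := fun s : Set.Icc 1 T => MeasurableSpace.comap (ξ s) inferInstance)
    (fun s => (hO.measurable_noise s s.2).comap_le) hO.indep.iIndep hdis
  simpa [past] using this

omit [IsProbabilityMeasure μ] in
theorem measurable_sgd_past (hO : IsStochasticOracle μ F W G T ξ h) (hW : IsClosed W)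
    (hc : Convex ℝ W) (hx₁ : x₁ ∈ W) (α : ℕ → ℝ) {t : ℕ} (htT : t ≤ T) :
    Measurable[past ξ T t] (sgd W α ξ h x₁ t) := by
  match t with
  | 0 => exact measurable_const
  | 1 => exact measurable_const
  | t + 2 =>
    have ih := measurable_sgd_past hO hW hc hx₁ α (by omega : t + 1 ≤ T)
    have ih' : Measurable[past ξ T (t + 2)] (sgd W α ξ h x₁ (t + 1)) :=
      ih.mono (past_mono (Nat.le_succ _)) le_rfl
    have hm : t + 1 ∈ Set.Icc 1 T := ⟨by omega, by omega⟩
    have hn : Measurable[past ξ T (t + 2)] (ξ (t + 1)) := measurable_noise_past hm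
    have h1 : Measurable[past ξ T (t + 2)]
        (fun ω => h (t + 1) (ξ (t + 1) ω) (sgd W α ξ h x₁ (t + 1) ω)) :=
      (hO.measurable_oracle (t + 1) hm).comp (hn.prodMk ih')
    exact (continuous_proj hW hc ⟨x₁, hx₁⟩).measurable.comp (ih'.sub (h1.const_smul (α (t + 1))))

omit [IsProbabilityMeasure μ] in
theorem measurable_refPoint_past (hO : IsStochasticOracle μ F W G T ξ h) (hW : IsClosed W)
    (hc : Convex ℝ W) (hx₁ : x₁ ∈ W) (α p : ℕ → ℝ) (y₀ : E) {t : ℕ} (htT : t ≤ T) :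
    Measurable[past ξ T t] (fun ω => refPoint p (fun s => sgd W α ξ h x₁ s ω) y₀ t) := by
  induction t with
  | zero => exact measurable_const
  | succ t ih =>
    have h1 := (ih (by omega)).mono (past_mono (ξ := ξ) (T := T) (Nat.le_succ t)) le_rfl
    have h2 := (measurable_sgd_past hO hW hc hx₁ α (by omega : t ≤ T)).mono
      (past_mono (ξ := ξ) (T := T) (Nat.le_succ t)) le_rfl
    exact (h1.const_smul (1 - p t)).add (h2.const_smul (p t))

/-- The iterate together with its reference point. -/
noncomputable def sgdState (W : Set E) (lam : ℝ) (T : ℕ) (ξ : ∀ t, Ω → Ξ t)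
    (h : ∀ t, Ξ t → E → E) (x₁ xs : E) (t : ℕ) (ω : Ω) : E × E :=
  (sgd W (stepSize lam T) ξ h x₁ t ω,
    refPoint (refWeight lam T) (fun s => sgd W (stepSize lam T) ξ h x₁ s ω) xs t)

omit [MeasurableSpace E] [BorelSpace E] mΩ [∀ t, MeasurableSpace (Ξ t)] in
theorem sgdState_mem (hW : IsClosed W) (hc : Convex ℝ W) (hlam : 0 < lam) (hx₁ : x₁ ∈ W)
    (hxs : xs ∈ W) {t : ℕ} (htT : t ≤ T) (ω : Ω) :
    sgdState W lam T ξ h x₁ xs t ω ∈ W ×ˢ W :=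
  ⟨iterate_mem hW _ _ hx₁ t,
    refPoint_mem hc hlam (fun s => iterate_mem hW _ _ hx₁ s) hxs htT⟩

omit [IsProbabilityMeasure μ] in
theorem measurable_sgdState (hO : IsStochasticOracle μ F W G T ξ h) (hW : IsClosed W)
    (hc : Convex ℝ W) (hx₁ : x₁ ∈ W) {t : ℕ} (htT : t ≤ T) :
    Measurable[past ξ T t] (sgdState W lam T ξ h x₁ xs t) :=
  (measurable_sgd_past hO hW hc hx₁ _ htT).prodMk
    (measurable_refPoint_past hO hW hc hx₁ _ _ _ htT)

theorem integrable_sgdState (hO : IsStochasticOracle μ F W G T ξ h) (hW : IsCompact W)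
    (hc : Convex ℝ W) (hlam : 0 < lam) (hx₁ : x₁ ∈ W) (hxs : xs ∈ W) {t : ℕ} (htT : t ≤ T)
    {Ψ : E × E → ℝ} (hΨ : Continuous Ψ) :
    Integrable (fun ω => Ψ (sgdState W lam T ξ h x₁ xs t ω)) μ := by
  obtain ⟨C, hC⟩ := (hW.prod hW).exists_bound_of_continuousOn hΨ.continuousOn
  refine Integrable.of_bound (hΨ.measurable.comp ((measurable_sgdState hO hW.isClosed hc hx₁
    htT).mono (past_le hO t) le_rfl)).aestronglyMeasurable C (ae_of_all _ fun ω => ?_)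
  exact hC _ (sgdState_mem hW.isClosed hc hlam hx₁ hxs htT ω)

/-- One step of SGD with its reference point: it suffices to average over the noise of this step
at a fixed state. -/
theorem integral_sgdState_succ_le (hO : IsStochasticOracle μ F W G T ξ h) (hW : IsCompact W)
    (hc : Convex ℝ W) (hlam : 0 < lam) (hx₁ : x₁ ∈ W) (hxs : xs ∈ W) {t : ℕ} (ht : 1 ≤ t)
    (htT : t < T) {Φ Ψ : E × E → ℝ} (hΦ : Continuous Φ) (hΨ : Continuous Ψ)
    (hΦ0 : ∀ z ∈ W ×ˢ W, 0 ≤ Φ z)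
    (hstep : ∀ x ∈ W, ∀ y ∈ W,
      ∫ ω, Φ (proj W (x - stepSize lam T t • h t (ξ t ω) x),
        (1 - refWeight lam T t) • y + refWeight lam T t • x) ∂μ ≤ Ψ (x, y)) :
    ∫ ω, Φ (sgdState W lam T ξ h x₁ xs (t + 1) ω) ∂μ
      ≤ ∫ ω, Ψ (sgdState W lam T ξ h x₁ xs t ω) ∂μ := by
  have hm : t ∈ Set.Icc 1 T := ⟨ht, htT.le⟩
  have hZ := measurable_sgdState (lam := lam) (xs := xs) hO hW.isClosed hc hx₁ htT.le
  -- The state at time t involves only noise before t. Freezing it matters because the oracle's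
  -- bound holds almost surely for each fixed point, with a null set that may depend on the point.
  have hind : IndepFun (sgdState W lam T ξ h x₁ xs t) (ξ t) μ :=
    indep_of_indep_of_le_left (indep_past hO hm) hZ.comap_le
  have e : ∀ ω, sgdState W lam T ξ h x₁ xs (t + 1) ω
      = (fun (z : E × E) (n : Ξ t) => (proj W (z.1 - stepSize lam T t • h t n z.1),
          (1 - refWeight lam T t) • z.2 + refWeight lam T t • z.1))
        (sgdState W lam T ξ h x₁ xs t ω) (ξ t ω) := by
    intro ω
    refine Prod.ext ?_ rfl
    exact iterate_succ (W := W) (stepSize lam T) (fun s => h s (ξ s ω)) x₁ ht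
  simp_rw [e]
  have hp := (continuous_proj hW.isClosed hc ⟨x₁, hx₁⟩).measurable
  have ho : Measurable fun q : (E × E) × Ξ t => h t q.2 q.1.1 :=
    (hO.measurable_oracle t hm).comp (measurable_snd.prodMk (measurable_fst.comp measurable_fst))
  refine integral_le_of_indepFun (hZ.mono (past_le hO t) le_rfl) (hO.measurable_noise t hm) hind
    (hW.isClosed.measurableSet.prod hW.isClosed.measurableSet)
    (sgdState_mem hW.isClosed hc hlam hx₁ hxs htT.le)
    (Φ := fun z n => Φ (proj W (z.1 - stepSize lam T t • h t n z.1),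
      (1 - refWeight lam T t) • z.2 + refWeight lam T t • z.1))
    (hΦ.measurable.comp (Measurable.prodMk
      (hp.comp ((measurable_fst.comp measurable_fst).sub (ho.const_smul _)))
      (by fun_prop))) hΨ.measurable
    (fun z hz n => hΦ0 _ ⟨(proj_spec hW.isClosed ⟨x₁, hx₁⟩ _).1, ?_⟩)
    (integrable_sgdState hO hW hc hlam hx₁ hxs htT.le hΨ) (fun z hz => hstep _ hz.1 _ hz.2)
  obtain ⟨h0, h1⟩ := refWeight_mem hlam htT
  exact hc hz.2 hz.1 (by linarith) h0 (by ring)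

end SGD

/-! ### Expectation and high-probability bounds for SGD. -/

section SGDBounds

variable {E : Type*} [NormedAddCommGroup E] [InnerProductSpace ℝ E] [FiniteDimensional ℝ E]
  {F : E → ℝ} {W : Set E} {G lam : ℝ} {T : ℕ} {xs x₁ : E}

/-- `W` lies in the ball of radius G/λ around `xs`. Compactness makes every continuous function of
the state integrable. -/
theorem isCompact_of_stronglyConvexOver (hW : IsClosed W) (hc : Convex ℝ W) (hlam : 0 < lam)
    (hL : LipschitzOver F W G) (hS : StronglyConvexOver F W lam)
    (hsub : ∀ x ∈ W, (subdifferential F x).Nonempty) (hxs : xs ∈ W) (hmin : IsMinOn F W xs) :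
    IsCompact W := by
  refine Metric.isCompact_of_isClosed_isBounded hW
    ((Metric.isBounded_closedBall (x := xs) (r := √(G ^ 2 / lam ^ 2))).subset fun x hx => ?_)
  rw [mem_closedBall_iff_norm]
  exact Real.le_sqrt_of_sq_le (norm_sub_sq_le_of_isMinOn hc hlam hL hS hsub hxs hmin hx)

omit [InnerProductSpace ℝ E] [FiniteDimensional ℝ E] in
theorem potential_nonneg (hmin : IsMinOn F W xs) {S : ℝ} (hS : 0 ≤ S) (x : E) {y : E}
    (hy : y ∈ W) : 0 ≤ potential F xs S x y := by
  have : F xs ≤ F y := hmin hy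
  have : 0 ≤ ‖x - y‖ ^ 2 / S := by positivity
  unfold potential
  linarith

theorem continuous_potential (hF : ConvexOn ℝ Set.univ F) (S : ℝ) :
    Continuous fun z : E × E => potential F xs S z.1 z.2 := by
  have := hF.locallyLipschitz.continuous
  unfold potential
  fun_prop

variable [MeasurableSpace E] [BorelSpace E] {Ω : Type*} [mΩ : MeasurableSpace Ω] {μ : Measure Ω}
  [IsProbabilityMeasure μ] {Ξ : ℕ → Type*} [∀ t, MeasurableSpace (Ξ t)]
  {ξ : ∀ t, Ω → Ξ t} {h : ∀ t, Ξ t → E → E}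

omit [FiniteDimensional ℝ E] [BorelSpace E] [IsProbabilityMeasure μ] in
theorem IsStochasticOracle.measurable_direction (hO : IsStochasticOracle μ F W G T ξ h) {t : ℕ}
    (ht : t ∈ Set.Icc 1 T) (x : E) : Measurable fun ω => h t (ξ t ω) x :=
  (hO.measurable_oracle t ht).comp ((hO.measurable_noise t ht).prodMk measurable_const)

omit [FiniteDimensional ℝ E] [BorelSpace E] [IsProbabilityMeasure μ] in
theorem IsStochasticOracle.subdifferential_nonempty (hO : IsStochasticOracle μ F W G T ξ h)
    (hT : 1 ≤ T) : ∀ x ∈ W, (subdifferential F x).Nonempty :=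
  fun x hx => ⟨_, hO.unbiased 1 ⟨le_rfl, hT⟩ x hx⟩

theorem sgd_integral_le (hF : ConvexOn ℝ Set.univ F) (hW : IsClosed W)
    (hc : Convex ℝ W) (hL : LipschitzOver F W G) (hlam : 0 < lam) (hS : StronglyConvexOver F W lam)
    (hxs : xs ∈ W) (hmin : IsMinOn F W xs) (hT : 1 ≤ T) (hx₁ : x₁ ∈ W)
    (hO : IsStochasticOracle μ F W G T ξ h) :
    Integrable (fun ω => F (sgd W (stepSize lam T) ξ h x₁ T ω)) μ ∧
      ∫ ω, F (sgd W (stepSize lam T) ξ h x₁ T ω) ∂μ ≤ F xs + 130 * G ^ 2 / (lam * T) := by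
  have hsub := hO.subdifferential_nonempty hT
  have hK := isCompact_of_stronglyConvexOver hW hc hlam hL hS hsub hxs hmin
  have hFc := hF.locallyLipschitz.continuous
  have hint : ∀ t ≤ T, ∀ {Ψ : E × E → ℝ}, Continuous Ψ →
      Integrable (fun ω => Ψ (sgdState W lam T ξ h x₁ xs t ω)) μ :=
    fun t ht _ hΨ => integrable_sgdState hO hK hc hlam hx₁ hxs ht hΨ
  have hi : Integrable (fun ω => F (sgd W (stepSize lam T) ξ h x₁ T ω)) μ :=
    hint T le_rfl (Ψ := fun z => F z.1) (by fun_prop)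
  refine ⟨hi, ?_⟩
  rw [← sub_le_iff_le_add']
  set Z := sgdState W lam T ξ h x₁ xs with hZ
  have hmem : ∀ t ≤ T, ∀ ω, Z t ω ∈ W ×ˢ W := fun t ht ω =>
    sgdState_mem hW hc hlam hx₁ hxs ht ω
  refine last_iterate_recursion hlam hT (d := fun t => ∫ ω, ‖(Z t ω).1 - xs‖ ^ 2 ∂μ)
    (P := fun t => ∫ ω, potential F xs (remaining lam T t) (Z t ω).1 (Z t ω).2 ∂μ)
    (fun t => integral_nonneg fun ω => sq_nonneg _) ?_ (fun t h1 h2 => ?_) ?_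
    (fun t h1 h2 => ?_) ?_
  · have : ∀ ω, (Z 1 ω).1 = x₁ := fun ω => rfl
    simp only [this, integral_const, probReal_univ, one_smul]
    exact norm_sub_sq_le_of_isMinOn hc hlam hL hS hsub hxs hmin hx₁
  · refine (integral_sgdState_succ_le hO hK hc hlam hx₁ hxs h1 (by omega)
      (Φ := fun z => ‖z.1 - xs‖ ^ 2)
      (Ψ := fun z => (1 - 2 * lam * stepSize lam T t) * ‖z.1 - xs‖ ^ 2
        + stepSize lam T t ^ 2 * G ^ 2) (by fun_prop) (by fun_prop)
      (fun z _ => sq_nonneg _) (fun x hx y _ => ?_)).trans (le_of_eq ?_)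
    · have hm : t ∈ Set.Icc 1 T := ⟨h1, by omega⟩
      exact integral_le_of_step (hO.measurable_direction hm x) (hO.bounded t hm x hx)
        (fun ω => sq_nonneg _) (sq_nonneg _) _ fun ω =>
          norm_step_sub_minimizer_sq_le hW hc hS hsub hxs hmin hx (hO.unbiased t hm x hx)
            (stepSize_pos hlam h1).le _
    · rw [integral_add ((hint t (by omega) (Ψ := fun z => ‖z.1 - xs‖ ^ 2)
        (by fun_prop)).const_mul _) (integrable_const _), integral_const_mul]
      simp [hZ]
  · have : ∀ ω, (Z (T / 2 + 1) ω).2 = xs := fun ω => refPoint_early _ xs le_rfl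
    simp only [this, potential, sub_self, mul_zero, add_zero, integral_div, le_refl]
  · have hS' := remaining_pos hlam (by omega : 1 ≤ t + 1) h2
    have ha := stepSize_pos (T := T) hlam (by omega : 1 ≤ t)
    refine (integral_sgdState_succ_le hO hK hc hlam hx₁ hxs (by omega) h2
      (Φ := fun z => potential F xs (remaining lam T (t + 1)) z.1 z.2)
      (Ψ := fun z => potential F xs (remaining lam T t) z.1 z.2
        + stepSize lam T t ^ 2 / remaining lam T (t + 1) * G ^ 2)
      (continuous_potential hF _) ((continuous_potential hF _).add continuous_const)
      (fun z hz => potential_nonneg hmin hS'.le _ hz.2) (fun x hx y hy => ?_)).trans (le_of_eq ?_)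
    · have hm : t ∈ Set.Icc 1 T := ⟨by omega, h2.le⟩
      obtain ⟨hp0, hp1⟩ := refWeight_mem hlam h2
      have e : refWeight lam T t
          = stepSize lam T t / (stepSize lam T t + remaining lam T (t + 1)) := by
        rw [refWeight, if_neg (by omega), remaining_eq_add h2.le]
      have key := integral_le_of_step (hO.measurable_direction hm x) (hO.bounded t hm x hx)
        (fun ω => potential_nonneg hmin hS'.le (proj W (x - stepSize lam T t • h t (ξ t ω) x))
          (hc hy hx (sub_nonneg.2 hp1) hp0 (by ring)))
        (by positivity) _ fun ω => e ▸
          potential_step_le (xs := xs) hF hW hc hx hy (hO.unbiased t hm x hx) ha.le hS' _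
      refine key.trans ?_
      rw [e]
      -- This gain is discarded in the mean bound; the exponential-moment bound spends it on the
      -- noise.
      have h5 : 0 ≤ stepSize lam T t / (stepSize lam T t + remaining lam T (t + 1))
        * (‖x - y‖ ^ 2 / (stepSize lam T t + remaining lam T (t + 1))) := by positivity
      simp only [potential, remaining_eq_add h2.le]
      linarith
    · rw [integral_add (hint t h2.le (continuous_potential hF _)) (integrable_const _)]
      simp [hZ]
  · have hP := hint T le_rfl (continuous_potential (xs := xs) hF (remaining lam T T))
    calc 2 * (∫ ω, F (sgd W (stepSize lam T) ξ h x₁ T ω) ∂μ - F xs)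
        = ∫ ω, 2 * (F (sgd W (stepSize lam T) ξ h x₁ T ω) - F xs) ∂μ := by
          rw [integral_const_mul, integral_sub hi (integrable_const _)]
          simp
      _ ≤ ∫ ω, (potential F xs (remaining lam T T) (Z T ω).1 (Z T ω).2
            + G ^ 2 * remaining lam T T) ∂μ :=
          integral_mono ((hi.sub (integrable_const _)).const_mul 2)
            (hP.add (integrable_const _)) fun ω =>
              potential_last_le hL hsub (hmem T le_rfl ω).1 _ (remaining_pos hlam hT le_rfl)
      _ = _ := by
          rw [integral_add hP (integrable_const _)]
          simp [hZ]

/-- Turns a contraction of the exponent by ρ into a contraction of the exponential moment towards 1.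
-/
theorem exp_mul_le {ρ : ℝ} (h0 : 0 ≤ ρ) (h1 : ρ ≤ 1) (u : ℝ) :
    Real.exp (ρ * u) ≤ 1 - ρ + ρ * Real.exp u := by
  have := convexOn_exp.2 (Set.mem_univ 0) (Set.mem_univ u) (sub_nonneg.2 h1) h0 (by ring)
  simpa using this

theorem exp_le_one_add_two_mul {u : ℝ} (h0 : 0 ≤ u) (h1 : u ≤ 1 / 2) :
    Real.exp u ≤ 1 + 2 * u := by
  have h2 := Real.add_one_le_exp (-u)
  rw [Real.exp_neg] at h2
  have h3 : Real.exp u * (1 - u) ≤ 1 := by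
    calc Real.exp u * (1 - u) ≤ Real.exp u * (Real.exp u)⁻¹ := by
          gcongr; linarith
      _ = 1 := mul_inv_cancel₀ (Real.exp_pos u).ne'
  nlinarith [Real.exp_pos u]

/-- The squared distances to the minimizer in the first half of the steps have exponential
moments at the scale `G² / (lam² t)`. -/
theorem sgd_integral_exp_sq_dist_le (hW : IsClosed W)
    (hc : Convex ℝ W) (hL : LipschitzOver F W G) (hlam : 0 < lam) (hG : 0 < G)
    (hS : StronglyConvexOver F W lam)
    (hxs : xs ∈ W) (hmin : IsMinOn F W xs) (hT : 1 ≤ T) (hx₁ : x₁ ∈ W)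
    (hO : IsStochasticOracle μ F W G T ξ h) {t : ℕ} (ht : 1 ≤ t) (htT : t ≤ T / 2 + 1) :
    ∫ ω, Real.exp (lam ^ 2 * t / (16 * G ^ 2) * ‖sgd W (stepSize lam T) ξ h x₁ t ω - xs‖ ^ 2) ∂μ
      ≤ 2 := by
  have hsub := hO.subdifferential_nonempty hT
  have hK := isCompact_of_stronglyConvexOver hW hc hlam hL hS hsub hxs hmin
  induction t, ht using Nat.le_induction with
  | base =>
    have e : ∀ ω, sgd W (stepSize lam T) ξ h x₁ 1 ω = x₁ := fun ω => rfl
    simp only [e, integral_const, probReal_univ, one_smul]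
    have h1 := norm_sub_sq_le_of_isMinOn hc hlam hL hS hsub hxs hmin hx₁
    have h2 : lam ^ 2 * (1 : ℕ) / (16 * G ^ 2) * ‖x₁ - xs‖ ^ 2 ≤ 1 / 16 := by
      calc lam ^ 2 * (1 : ℕ) / (16 * G ^ 2) * ‖x₁ - xs‖ ^ 2
          ≤ lam ^ 2 * (1 : ℕ) / (16 * G ^ 2) * (G ^ 2 / lam ^ 2) := by gcongr
        _ = 1 / 16 := by push_cast; field_simp
    have h3 := exp_le_one_add_two_mul (u := 1 / 16) (by norm_num) (by norm_num)
    linarith [Real.exp_le_exp.2 h2]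
  | succ t ht ih =>
    have htT' : t ≤ T := by omega
    have ih := ih (by omega)
    have h0 : (1 : ℝ) ≤ t := by exact_mod_cast ht
    have ht0 : (0 : ℝ) < t := by linarith
    set s : ℝ := lam ^ 2 * t / (16 * G ^ 2) with hs
    set s' : ℝ := lam ^ 2 * ((t + 1 : ℕ) : ℝ) / (16 * G ^ 2) with hs'
    have hs0 : 0 ≤ s' := by positivity
    -- In the exponent the drift gives (t+1)(1 - 2/t) ≤ t - 1 and the noise at most 1/2; their sum
    -- is at most t - 1/2 = ρt.
    set ρ : ℝ := 1 - 1 / (2 * t) with hρ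
    have hρ0 : 0 ≤ ρ := by
      rw [hρ, sub_nonneg, div_le_one (by positivity)]; linarith
    have hρ1 : ρ ≤ 1 := by
      have : 0 ≤ 1 / (2 * (t : ℝ)) := by positivity
      linarith
    have hΨc : Continuous fun z : E × E => Real.exp (s * ‖z.1 - xs‖ ^ 2) := by fun_prop
    have hint := (integrable_sgdState (lam := lam) (T := T) hO hK hc hlam hx₁ hxs htT' hΨc)
    have hstep := integral_sgdState_succ_le (T := T) hO hK hc hlam hx₁ hxs ht (by omega)
      (Φ := fun z => Real.exp (s' * ‖z.1 - xs‖ ^ 2))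
      (Ψ := fun z => (1 + 1 / (4 * t)) * (1 - ρ + ρ * Real.exp (s * ‖z.1 - xs‖ ^ 2)))
      (by fun_prop) (by fun_prop) (fun z _ => (Real.exp_pos _).le) (fun x hx y _ => by
        have hm : t ∈ Set.Icc 1 T := ⟨ht, htT'⟩
        have key := integral_exp_le_of_step (hO.measurable_direction hm x) (hO.bounded t hm x hx)
          (sq_nonneg _) hs0 _ fun ω =>
            norm_step_sub_minimizer_sq_le hW hc hS hsub hxs hmin hx (hO.unbiased t hm x hx)
              (stepSize_pos (T := T) hlam ht).le _
        refine key.trans ?_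
        rw [stepSize_early ht (by omega), norm_smul, mul_pow, Real.norm_eq_abs, sq_abs]
        set D := ‖x - xs‖ ^ 2 with hD
        have hD0 : 0 ≤ D := sq_nonneg _
        have hexp : s' * ((1 - 2 * lam * (1 / (lam * t))) * D + (1 / (lam * t)) ^ 2 * G ^ 2)
            + s' ^ 2 * (G ^ 2 * ((2 * (1 / (lam * t))) ^ 2 * D)) / 2 ≤ 1 / (8 * t) + ρ * (s * D) := by
          have e1 : s' * ((1 - 2 * lam * (1 / (lam * t))) * D + (1 / (lam * t)) ^ 2 * G ^ 2)
            + s' ^ 2 * (G ^ 2 * ((2 * (1 / (lam * t))) ^ 2 * D)) / 2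
            = ((t : ℝ) + 1) / (16 * t ^ 2) + lam ^ 2 / (16 * G ^ 2) * D *
              ((t + 1) * (1 - 2 / t) + (t + 1) ^ 2 / (8 * t ^ 2)) := by
            rw [hs']; push_cast; field_simp; ring
          have e2 : ρ * (s * D) = lam ^ 2 / (16 * G ^ 2) * D * (t - 1 / 2) := by
            rw [hs, hρ]; field_simp
          rw [e1, e2]
          have i1 : ((t : ℝ) + 1) / (16 * t ^ 2) ≤ 1 / (8 * t) := by
            rw [div_le_div_iff₀ (by positivity) (by positivity)]
            nlinarith
          have i2 : ((t : ℝ) + 1) * (1 - 2 / t) + (t + 1) ^ 2 / (8 * t ^ 2) ≤ t - 1 / 2 := by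
            have j1 : ((t : ℝ) + 1) ^ 2 / (8 * t ^ 2) ≤ 1 / 2 := by
              rw [div_le_div_iff₀ (by positivity) (by positivity)]
              nlinarith
            have j2 : ((t : ℝ) + 1) * (1 - 2 / t) = t - 1 - 2 / t := by field_simp; ring
            have j3 : 0 ≤ 2 / (t : ℝ) := by positivity
            linarith
          gcongr
        refine (Real.exp_le_exp.2 hexp).trans ?_
        rw [Real.exp_add]
        refine mul_le_mul ?_ (exp_mul_le hρ0 hρ1 _) (Real.exp_pos _).le (by positivity)
        have hu : 1 / (8 * (t : ℝ)) ≤ 1 / 2 := by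
          rw [div_le_div_iff₀ (by positivity) (by positivity)]; linarith
        refine (exp_le_one_add_two_mul (by positivity) hu).trans (le_of_eq ?_)
        field_simp
        ring)
    refine hstep.trans ?_
    rw [integral_const_mul, integral_add (integrable_const _) (hint.const_mul _),
      integral_const_mul, integral_const, probReal_univ, one_smul]
    have ih' : ∫ ω, Real.exp (s * ‖(sgdState W lam T ξ h x₁ xs t ω).1 - xs‖ ^ 2) ∂μ ≤ 2 := ih
    -- Since 1 + ρ = 2(1 - 1/(4t)), the factor 1 + 1/(4t) is compensated and the bound 2 reproduces
    -- itself.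
    calc (1 + 1 / (4 * (t : ℝ))) * (1 - ρ
          + ρ * ∫ ω, Real.exp (s * ‖(sgdState W lam T ξ h x₁ xs t ω).1 - xs‖ ^ 2) ∂μ)
        ≤ (1 + 1 / (4 * (t : ℝ))) * (1 - ρ + ρ * 2) := by gcongr
      _ = 2 - 1 / (8 * (t : ℝ) ^ 2) := by rw [hρ]; field_simp; ring
      _ ≤ 2 := by
        have : 0 ≤ 1 / (8 * (t : ℝ) ^ 2) := by positivity
        linarith

/-- The potential keeps its exponential moment in the second half of the steps. -/
theorem sgd_integral_exp_potential_succ_le (hF : ConvexOn ℝ Set.univ F) (hW : IsCompact W)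
    (hc : Convex ℝ W) (hlam : 0 < lam) (hxs : xs ∈ W) (hx₁ : x₁ ∈ W)
    (hO : IsStochasticOracle μ F W G T ξ h) {θ : ℝ} (hθ : 0 ≤ θ)
    {t : ℕ} (ht : T < 2 * t) (htT : t < T) (hθt : 2 * θ * G ^ 2 * stepSize lam T t ≤ 1) :
    ∫ ω, Real.exp (θ * potential F xs (remaining lam T (t + 1))
        (sgdState W lam T ξ h x₁ xs (t + 1) ω).1 (sgdState W lam T ξ h x₁ xs (t + 1) ω).2) ∂μ
      ≤ Real.exp (θ * (128 / (lam * T ^ 2) * G ^ 2))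
        * ∫ ω, Real.exp (θ * potential F xs (remaining lam T t)
          (sgdState W lam T ξ h x₁ xs t ω).1 (sgdState W lam T ξ h x₁ xs t ω).2) ∂μ := by
  have hS' := remaining_pos hlam (by omega : 1 ≤ t + 1) htT
  have ha := stepSize_pos (T := T) hlam (by omega : 1 ≤ t)
  have hcont : ∀ S, Continuous fun z : E × E => Real.exp (θ * potential F xs S z.1 z.2) :=
    fun S => Real.continuous_exp.comp (continuous_const.mul (continuous_potential hF S))
  rw [← integral_const_mul]
  refine integral_sgdState_succ_le hO hW hc hlam hx₁ hxs (by omega) htT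
    (Φ := fun z => Real.exp (θ * potential F xs (remaining lam T (t + 1)) z.1 z.2))
    (Ψ := fun z => Real.exp (θ * (128 / (lam * T ^ 2) * G ^ 2))
      * Real.exp (θ * potential F xs (remaining lam T t) z.1 z.2))
    (hcont _) (continuous_const.mul (hcont _)) (fun z _ => (Real.exp_pos _).le)
    (fun x hx y hy => ?_)
  have hm : t ∈ Set.Icc 1 T := ⟨by omega, htT.le⟩
  have e : refWeight lam T t
      = stepSize lam T t / (stepSize lam T t + remaining lam T (t + 1)) := by
    rw [refWeight, if_neg (by omega), remaining_eq_add htT.le]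
  have key := integral_exp_le_of_step (hO.measurable_direction hm x) (hO.bounded t hm x hx)
    (by positivity) hθ _ fun ω => e ▸
      potential_step_le (xs := xs) hF hW.isClosed hc hx hy (hO.unbiased t hm x hx) ha.le hS' _
  refine key.trans ?_
  rw [e, ← Real.exp_add, norm_smul, mul_pow, Real.norm_eq_abs, sq_abs]
  refine Real.exp_le_exp.2 ?_
  have h1 := sq_stepSize_div_remaining_le hlam ht htT
  simp only [potential, remaining_eq_add htT.le]
  set a := stepSize lam T t
  set S := remaining lam T (t + 1)
  set q := ‖x - y‖ ^ 2 / (a + S) with hq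
  have hq0 : 0 ≤ q := by positivity
  -- The noise term is 2θG²a times the contraction gain θpq, with p = a/(a+S), so the smallness of θ
  -- lets the gain absorb it.
  have h2 : θ ^ 2 * (G ^ 2 * ((2 * (a / (a + S))) ^ 2 * ‖x - y‖ ^ 2)) / 2
      = 2 * θ * G ^ 2 * a * (θ * (a / (a + S)) * q) := by
    rw [hq]; field_simp
  rw [h2]
  have h3 : 2 * θ * G ^ 2 * a * (θ * (a / (a + S)) * q) ≤ 1 * (θ * (a / (a + S)) * q) := by
    gcongr
  have h4 : θ * (a ^ 2 / S * G ^ 2) ≤ θ * (128 / (lam * T ^ 2) * G ^ 2) := by gcongr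
  linarith

theorem sgd_integral_exp_le (hF : ConvexOn ℝ Set.univ F) (hW : IsClosed W)
    (hc : Convex ℝ W) (hL : LipschitzOver F W G) (hlam : 0 < lam) (hG : 0 < G)
    (hS : StronglyConvexOver F W lam)
    (hxs : xs ∈ W) (hmin : IsMinOn F W xs) (hT : 1 ≤ T) (hx₁ : x₁ ∈ W)
    (hO : IsStochasticOracle μ F W G T ξ h) :
    ∫ ω, Real.exp (lam * T / (256 * G ^ 2)
      * (F (sgd W (stepSize lam T) ξ h x₁ T ω) - F xs)) ∂μ ≤ Real.exp 2 := by
  have hsub := hO.subdifferential_nonempty hT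
  have hK := isCompact_of_stronglyConvexOver hW hc hlam hL hS hsub hxs hmin
  have hT0 : (0 : ℝ) < T := by exact_mod_cast hT
  -- Chosen so that θ · 16λ = λ²(T/2)/(16G²): with S ≥ 1/(16λ) at the midpoint, the initial
  -- exponential moment is covered by that of the squared distance.
  set θ := lam * T / (512 * G ^ 2) with hθ
  have hθ0 : 0 ≤ θ := by positivity
  set Z := sgdState W lam T ξ h x₁ xs with hZ
  have hcont : ∀ S, Continuous fun z : E × E => Real.exp (θ * potential F xs S z.1 z.2) :=
    fun S => Real.continuous_exp.comp (continuous_const.mul (continuous_potential hF S))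
  set M : ℕ → ℝ := fun t => ∫ ω, Real.exp (θ * potential F xs (remaining lam T t)
    (Z t ω).1 (Z t ω).2) ∂μ with hM
  have hMint : ∀ t ≤ T, Integrable (fun ω => Real.exp (θ * potential F xs (remaining lam T t)
      (Z t ω).1 (Z t ω).2)) μ :=
    fun t ht => integrable_sgdState hO hK hc hlam hx₁ hxs ht (hcont _)
  have hMpos : ∀ t ≤ T, 0 < M t := fun t ht => integral_exp_pos (hMint t ht)
  -- Logarithms make the multiplicative growth of the moments additive; it totals at most 1/8.
  have hlog := le_add_mul_of_late_step (T := T) (P := fun t => Real.log (M t))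
    (c := θ * (128 / (lam * T ^ 2) * G ^ 2)) (fun t h1 h2 => by
      have hα := stepSize_le_two_div hlam h1 hT
      have hθt : 2 * θ * G ^ 2 * stepSize lam T t ≤ 1 := by
        calc 2 * θ * G ^ 2 * stepSize lam T t ≤ 2 * θ * G ^ 2 * (2 / (lam * T)) := by gcongr
          _ = 1 / 128 := by rw [hθ]; field_simp; norm_num
          _ ≤ 1 := by norm_num
      have := sgd_integral_exp_potential_succ_le hF hK hc hlam hxs hx₁ hO hθ0 h1 h2 hθt
      calc Real.log (M (t + 1)) ≤ Real.log (Real.exp (θ * (128 / (lam * T ^ 2) * G ^ 2)) * M t) :=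
            Real.log_le_log (hMpos _ h2) this
        _ = _ := by
          rw [Real.log_mul (Real.exp_pos _).ne' (hMpos t h2.le).ne', Real.log_exp, add_comm])
    (t := T) (by omega) le_rfl
  have hn : (T : ℝ) ≤ 2 * ((T / 2 + 1 : ℕ) : ℝ) := by
    exact_mod_cast (by omega : T ≤ 2 * (T / 2 + 1))
  have hstart : M (T / 2 + 1) ≤ 2 := by
    refine le_trans (integral_mono (hMint _ (by omega)) ?_ fun ω => ?_)
      (sgd_integral_exp_sq_dist_le hW hc hL hlam hG hS hxs hmin hT hx₁ hO
        (t := T / 2 + 1) (by omega) le_rfl)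
    · exact integrable_sgdState (lam := lam) (T := T) hO hK hc hlam hx₁ hxs (by omega)
        (Ψ := fun z => Real.exp (lam ^ 2 * (T / 2 + 1 : ℕ) / (16 * G ^ 2) * ‖z.1 - xs‖ ^ 2))
        (by fun_prop)
    · have e : (Z (T / 2 + 1) ω).2 = xs := refPoint_early _ xs le_rfl
      simp only [e, potential, sub_self, mul_zero, add_zero]
      refine Real.exp_le_exp.2 ?_
      have hr := one_div_le_remaining hlam hT
      calc θ * (‖(Z (T / 2 + 1) ω).1 - xs‖ ^ 2 / remaining lam T (T / 2 + 1))
          ≤ θ * (‖(Z (T / 2 + 1) ω).1 - xs‖ ^ 2 / (1 / (16 * lam))) := by gcongr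
        _ = lam ^ 2 * (T / 2) / (16 * G ^ 2) * ‖(Z (T / 2 + 1) ω).1 - xs‖ ^ 2 := by
            rw [hθ]; field_simp; ring
        _ ≤ lam ^ 2 * (T / 2 + 1 : ℕ) / (16 * G ^ 2) * ‖(Z (T / 2 + 1) ω).1 - xs‖ ^ 2 := by
            gcongr; linarith
  have hlog2 : Real.log (M (T / 2 + 1)) ≤ 1 := by
    calc Real.log (M (T / 2 + 1)) ≤ M (T / 2 + 1) - 1 :=
          Real.log_le_sub_one_of_pos (hMpos _ (by omega))
      _ ≤ 1 := by linarith
  have hlogT : Real.log (M T) ≤ 1 + 1 / 8 := by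
    have : ((T : ℝ) - (T / 2 + 1 : ℕ)) * (θ * (128 / (lam * T ^ 2) * G ^ 2)) ≤ 1 / 8 := by
      calc ((T : ℝ) - (T / 2 + 1 : ℕ)) * (θ * (128 / (lam * T ^ 2) * G ^ 2))
          ≤ (T / 2) * (θ * (128 / (lam * T ^ 2) * G ^ 2)) := by
            gcongr; linarith
        _ = 1 / 8 := by rw [hθ]; field_simp; norm_num
    linarith
  have hlast : θ * (G ^ 2 * remaining lam T T) ≤ 1 / 256 := by
    rw [remaining_self]
    calc θ * (G ^ 2 * stepSize lam T T) ≤ θ * (G ^ 2 * (2 / (lam * T))) := by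
          gcongr; exact stepSize_le_two_div hlam (by omega) hT
      _ = 1 / 256 := by rw [hθ]; field_simp; norm_num
  calc ∫ ω, Real.exp (lam * T / (256 * G ^ 2)
        * (F (sgd W (stepSize lam T) ξ h x₁ T ω) - F xs)) ∂μ
      ≤ ∫ ω, Real.exp (1 / 256) * Real.exp (θ * potential F xs (remaining lam T T)
          (Z T ω).1 (Z T ω).2) ∂μ := by
        refine integral_mono_of_nonneg (ae_of_all _ fun ω => (Real.exp_pos _).le)
          ((hMint T le_rfl).const_mul _) (ae_of_all _ fun ω => ?_)
        beta_reduce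
        rw [← Real.exp_add]
        refine Real.exp_le_exp.2 ?_
        have h1 := potential_last_le (xs := xs) hL hsub
          (sgdState_mem (T := T) (ξ := ξ) (h := h) (t := T) hW hc hlam hx₁ hxs le_rfl ω).1 (Z T ω).2
          (remaining_pos hlam hT le_rfl)
        have h2 := mul_le_mul_of_nonneg_left h1 hθ0
        have h3 : lam * T / (256 * G ^ 2) * (F (sgd W (stepSize lam T) ξ h x₁ T ω) - F xs)
            = θ * (2 * (F (Z T ω).1 - F xs)) := by
          rw [hθ, show (Z T ω).1 = sgd W (stepSize lam T) ξ h x₁ T ω from rfl]; field_simp; ring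
        rw [h3]
        rw [mul_add] at h2
        exact h2.trans (by linarith)
    _ = Real.exp (1 / 256) * Real.exp (Real.log (M T)) := by
        rw [integral_const_mul, Real.exp_log (hMpos T le_rfl)]
    _ ≤ Real.exp 2 := by
        rw [← Real.exp_add]
        exact Real.exp_le_exp.2 (by linarith)

/-- Chernoff's bound at scale λT/(256G²). The constant is 768 = 3 · 256, because 2 - 3 log(1/δ) ≤
-log(1/δ) once δ ≤ 1/e. -/
theorem sgd_highProbability (hF : ConvexOn ℝ Set.univ F) (hW : IsClosed W)
    (hc : Convex ℝ W) (hL : LipschitzOver F W G) (hlam : 0 < lam) (hS : StronglyConvexOver F W lam)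
    (hxs : xs ∈ W) (hmin : IsMinOn F W xs) (hT : 1 ≤ T) (hx₁ : x₁ ∈ W)
    (hO : IsStochasticOracle μ F W G T ξ h) {δ : ℝ} (hδ : 0 < δ) (hδe : δ ≤ 1 / Real.exp 1) :
    1 - δ ≤ μ.real {ω | |F (sgd W (stepSize lam T) ξ h x₁ T ω) - F xs|
      ≤ 768 * (G ^ 2 * Real.log (1 / δ) / (lam * T))} := by
  have hsub := hO.subdifferential_nonempty hT
  have hK := isCompact_of_stronglyConvexOver hW hc hlam hL hS hsub hxs hmin
  have hT0 : (0 : ℝ) < T := by exact_mod_cast hT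
  have hx : ∀ ω, sgd W (stepSize lam T) ξ h x₁ T ω ∈ W := fun ω => iterate_mem hW _ _ hx₁ T
  have habs : ∀ ω, |F (sgd W (stepSize lam T) ξ h x₁ T ω) - F xs|
      = F (sgd W (stepSize lam T) ξ h x₁ T ω) - F xs := fun ω =>
    abs_of_nonneg (sub_nonneg.2 (hmin (hx ω)))
  simp_rw [habs]
  have hlogδ : 1 ≤ Real.log (1 / δ) := by
    rw [Real.le_log_iff_exp_le (by positivity), le_div_iff₀ hδ]
    rwa [le_div_iff₀ (Real.exp_pos 1), mul_comm] at hδe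
  have hG0 : 0 ≤ G := (norm_nonneg _).trans (hL _ hxs _ (hsub _ hxs).some_mem)
  -- For G = 0 the exponential scale is meaningless, but the gap is at most G²/(2λ) = 0.
  rcases hG0.eq_or_lt with hG | hG
  · have : ∀ ω, F (sgd W (stepSize lam T) ξ h x₁ T ω) - F xs
        ≤ 768 * (G ^ 2 * Real.log (1 / δ) / (lam * T)) := by
      intro ω
      have := sub_le_of_isMinOn hlam hL hS hsub hxs (hx ω)
      rw [← hG] at this ⊢
      simpa using this
    simp only [this, Set.ofPred_true, probReal_univ]
    linarith
  · set X : Ω → ℝ := fun ω => F (sgd W (stepSize lam T) ξ h x₁ T ω) - F xs with hX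
    set ε := 768 * (G ^ 2 * Real.log (1 / δ) / (lam * T)) with hε
    have hFc := hF.locallyLipschitz.continuous
    have hXm : Measurable X :=
      (hFc.measurable.comp ((measurable_sgd_past hO hW hc hx₁ _ le_rfl).mono
        (past_le hO T) le_rfl)).sub_const _
    have hchern := measure_ge_le_exp_mul_mgf (μ := μ) (X := X) (t := lam * T / (256 * G ^ 2)) ε
      (by positivity) (integrable_sgdState (lam := lam) (T := T) hO hK hc hlam hx₁ hxs le_rfl
        (Ψ := fun z => Real.exp (lam * T / (256 * G ^ 2) * (F z.1 - F xs))) (by fun_prop))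
    have hmgf : mgf X μ (lam * T / (256 * G ^ 2)) ≤ Real.exp 2 :=
      sgd_integral_exp_le hF hW hc hL hlam hG hS hxs hmin hT hx₁ hO
    have hbad : μ.real {ω | ε ≤ X ω} ≤ δ := by
      refine hchern.trans ?_
      calc Real.exp (-(lam * T / (256 * G ^ 2)) * ε) * mgf X μ (lam * T / (256 * G ^ 2))
          ≤ Real.exp (-(lam * T / (256 * G ^ 2)) * ε) * Real.exp 2 := by gcongr
        _ = Real.exp (2 - 3 * Real.log (1 / δ)) := by
            rw [← Real.exp_add, hε]
            congr 1
            field_simp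
            ring
        _ ≤ Real.exp (-Real.log (1 / δ)) := Real.exp_le_exp.2 (by linarith)
        _ = δ := by rw [one_div, Real.log_inv, neg_neg, Real.exp_log hδ]
    have hcompl : μ.real {ω | X ω ≤ ε} = 1 - μ.real {ω | X ω ≤ ε}ᶜ := by
      rw [probReal_compl_eq_one_sub (measurableSet_le hXm measurable_const)]
      ring
    rw [hcompl]
    have : μ.real {ω | X ω ≤ ε}ᶜ ≤ μ.real {ω | ε ≤ X ω} :=
      measureReal_mono fun ω hω => by
        simp only [Set.mem_compl_iff, Set.mem_ofPred_eq, not_le] at hω ⊢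
        exact hω.le
    linarith

end SGDBounds

end LastIterate

theorem theorem2 :
    ∃ C : ℝ, 0 < C ∧
      ∀ (d : ℕ) (F : EuclideanSpace ℝ (Fin d) → ℝ) (W : Set (EuclideanSpace ℝ (Fin d)))
        (G lam : ℝ) (xstar : EuclideanSpace ℝ (Fin d)),
        ConvexOn ℝ Set.univ F → IsClosed W → Convex ℝ W →
        LipschitzOver F W G → 0 < lam → StronglyConvexOver F W lam →
        xstar ∈ W → IsMinOn F W xstar →
        ∀ T : ℕ, 1 ≤ T → ∀ x₁ ∈ W,
          -- SGD
          (∀ (Ω : Type*) [MeasurableSpace Ω] (μ : Measure Ω) [IsProbabilityMeasure μ]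
            (Ξ : ℕ → Type*) [∀ t, MeasurableSpace (Ξ t)] (ξ : ∀ t, Ω → Ξ t)
            (h : ∀ t, Ξ t → EuclideanSpace ℝ (Fin d) → EuclideanSpace ℝ (Fin d)),
            IsStochasticOracle μ F W G T ξ h →
            (Integrable (fun ω => F (sgd W (stepSize lam T) ξ h x₁ T ω)) μ ∧
              ∫ ω, F (sgd W (stepSize lam T) ξ h x₁ T ω) ∂μ
                ≤ F xstar + 130 * G ^ 2 / (lam * T)) ∧
            ∀ δ : ℝ, 0 < δ → δ ≤ 1 / Real.exp 1 →
              1 - δ ≤ μ.real {ω | |F (sgd W (stepSize lam T) ξ h x₁ T ω) - F xstar|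
                ≤ C * (G ^ 2 * Real.log (1 / δ) / (lam * T))}) ∧
          -- GD
          (∀ g : ℕ → EuclideanSpace ℝ (Fin d) → EuclideanSpace ℝ (Fin d),
            (∀ t ∈ Set.Icc 1 T, ∀ x ∈ W, g t x ∈ subdifferential F x) →
            F (iterate W (stepSize lam T) g x₁ T) ≤ F xstar + 130 * G ^ 2 / (lam * T)) := by
  refine ⟨768, by norm_num, fun d F W G lam xstar hF hW hc hL hlam hS hxs hmin T hT x₁ hx₁ =>
    ⟨?_, fun g hg => gradientDescent_last_iterate_le hF hW hc hL hlam hS hxs hmin hT hx₁ hg⟩⟩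
  intro Ω _ μ _ Ξ _ ξ h hO
  exact ⟨sgd_integral_le hF hW hc hL hlam hS hxs hmin hT hx₁ hO, fun δ hδ hδe =>
    sgd_highProbability hF hW hc hL hlam hS hxs hmin hT hx₁ hO hδ hδe⟩
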